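/- **Setting.** Let $K$ be a finite geometric simplicial complex in $\mathbb{R}^d$ with $n_0$ vertices and $n_1$ edges; $K_0$ denotes its vertex set and $K_1$ its edge set. Let $b_1,b_2\in\mathbb{R}^d$ be orthonormal (for instance $b_1=e_1$, $b_2=e_2$), and write $x_i(v)=b_i\cdot v$. Assume that the vertices of $K$ have pairwise distinct heights $x_1(v)$, and that no three distinct vertices of $K$ have collinear orthogonal projections to the plane spanned by $b_1,b_2$. "Above" and "below" refer to $x_1$. For a unit vector $s$, the lower-star filter is $h_s(\sigma)=\max\{s\cdot v : v \text{ a vertex of }\sigma\}$. A compatible index filtration is a numbering $\sigma_1,\dots,\sigma_n$ of all simplices of $K$ in which every simplex comes after its proper faces and $h_s(\sigma_i)<h_s(\sigma_j)$ implies $i<j$. The $k$-dimensional augmented persistence diagram of $K$ in direction $s$ is the multiset of the points $(h_s(\sigma_i),h_s(\sigma_j))$, one for each point $(i,j)$ of the $k$-dimensional persistence diagram (homology over a fixed field) of this index filtration, with $h_s(\sigma_\infty)=\infty$. An oracle for $K$ returns, for a unit vector $s$, the augmented persistence diagrams of all dimensions in direction $s$, as lists of points; one such call counts as one diagram and takes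 time $\Pi\ge 1$. All other access to $K$ is through the list of its vertex locations. Real arithmetic, comparisons, trigonometric functions, reading the coordinates $x_1(v),x_2(v)$, and elementary list operations take one step each. **Algorithm find-edges.** Input: a list $V$ of the vertex locations, each once. 1. Request the diagram $D$ in direction $-b_1$, and sort $V$ by increasing height $x_1$ (merge sort). 2. Process the vertices $v$ in this order. The neighbours of $v$ below $v$ are known at this time. Let $c$ be the number of deaths at $-x_1(v)$ in dimension $0$ of $D$ plus the number of births at $-x_1(v)$ in dimension $1$ of $D$. If $c=0$, go to the next vertex. Otherwise sort the other vertices by decreasing angle (in $(0,\pi)$, measured from $b_2$ towards $b_1$ in the $(b_2,b_1)$-plane) of the projected line joining them to $v$, let $\theta$ be the smallest angle between two of these lines, and initialise a stack with one edge interval: the list of the vertices above $v$, in this (clockwise) order, with edge count $c$. 3. While the stack is non-empty, pop an edge interval. If its edge count is $0$, drop it. If it has a single vertex $u$, record $u$ as a neighbour of $v$. Otherwise let $u$ be the last vertex of the first half (rounded down) of its list, at angle $\alpha$ as seen from $v$; request the diagram in direction $s=\cos(\varphi)\,b_2+\sin(\varphi)\,b_1$ with $\varphi=\alpha-\frac{\pi}{2}-\frac{\theta}{2}$,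 and let $c_\ell$ be the number of deaths at height $s\cdot v$ in dimension $0$ plus the number of births at height $s\cdot v$ in dimension $1$, minus the number of already known neighbours $w$ of $v$ with $s\cdot w<s\cdot v$. Push the second half with the remaining edge count, and then the first half with edge count $c_\ell$. 4. The edges found at $v$ are the pairs $(v,u)$ with $u$ a recorded neighbour above $v$. Output all edges found. **Theorem (Edge Reconstruction).** There is an absolute constant $C$ such that for every $d$, every coefficient field, every $K$ and $b_1,b_2$ as above, every oracle for $K$ and every listing $V$ of $K_0$, Algorithm find-edges run on $V$ outputs exactly the edges of $K$, each one exactly once; it requests at most $$C\,(n_1\log n_0+1)$$ diagrams, and its running time is at most $$C\,(n_1\log n_0+1)\,(n_0^2+\Pi).$$ (Here $\log 0$ is read as $0$.) -/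

import Mathlib

open scoped Classical in
/-- The simplicial boundary operator on formal combinations of finite vertex sets (unreduced: a
vertex has boundary zero). Vertices of a simplex are ordered by `rk`, which fixes the signs. -/
noncomputable def bdry {E : Type*} (𝔽 : Type*) [Field 𝔽] (rk : E → ℕ) :
    (Finset E →₀ 𝔽) →ₗ[𝔽] (Finset E →₀ 𝔽) :=
  Finsupp.linearCombination 𝔽 fun σ : Finset E =>
    if 2 ≤ σ.card then
      ∑ v ∈ σ, Finsupp.single (σ.erase v) ((-1 : 𝔽) ^ (σ.filter fun u => rk u < rk v).card)
    else 0

/-- `k`-chains of the subcomplex `F`: a `k`-simplex has `k + 1` vertices. -/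
noncomputable def chains {E : Type*} (𝔽 : Type*) [Field 𝔽] (F : Set (Finset E)) (k : ℕ) :
    Submodule 𝔽 (Finset E →₀ 𝔽) :=
  Finsupp.supported 𝔽 𝔽 {σ | σ ∈ F ∧ σ.card = k + 1}

noncomputable def cycles {E : Type*} (𝔽 : Type*) [Field 𝔽] (rk : E → ℕ) (F : Set (Finset E))
    (k : ℕ) : Submodule 𝔽 (Finset E →₀ 𝔽) :=
  chains 𝔽 F k ⊓ LinearMap.ker (bdry 𝔽 rk)

noncomputable def boundaries {E : Type*} (𝔽 : Type*) [Field 𝔽] (rk : E → ℕ) (F : Set (Finset E))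
    (k : ℕ) : Submodule 𝔽 (Finset E →₀ 𝔽) :=
  (chains 𝔽 F (k + 1)).map (bdry 𝔽 rk)

/-- Simplicial homology `H_k(F) = Z_k / B_k`, realised as the subspace `Z_k / B_k` of the quotient
of all chains by `B_k`. -/
noncomputable def homology {E : Type*} (𝔽 : Type*) [Field 𝔽] (rk : E → ℕ) (F : Set (Finset E))
    (k : ℕ) : Submodule 𝔽 ((Finset E →₀ 𝔽) ⧸ boundaries 𝔽 rk F k) :=
  (cycles 𝔽 rk F k).map (boundaries 𝔽 rk F k).mkQ

theorem chains_mono {E : Type*} (𝔽 : Type*) [Field 𝔽] {F G : Set (Finset E)} (h : F ⊆ G) (k : ℕ) :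
    chains 𝔽 F k ≤ chains 𝔽 G k :=
  Finsupp.supported_mono fun _ hσ => ⟨h hσ.1, hσ.2⟩

theorem cycles_mono {E : Type*} (𝔽 : Type*) [Field 𝔽] (rk : E → ℕ) {F G : Set (Finset E)}
    (h : F ⊆ G) (k : ℕ) : cycles 𝔽 rk F k ≤ cycles 𝔽 rk G k :=
  inf_le_inf_right _ (chains_mono 𝔽 h k)

theorem boundaries_mono {E : Type*} (𝔽 : Type*) [Field 𝔽] (rk : E → ℕ) {F G : Set (Finset E)}
    (h : F ⊆ G) (k : ℕ) : boundaries 𝔽 rk F k ≤ boundaries 𝔽 rk G k :=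
  Submodule.map_mono (chains_mono 𝔽 h (k + 1))

/-- The map `H_k(F) → H_k(G)` induced by an inclusion `F ⊆ G`: the class of a cycle of `F` goes to
its class in `G`. -/
noncomputable def homologyMap {E : Type*} (𝔽 : Type*) [Field 𝔽] (rk : E → ℕ)
    {F G : Set (Finset E)} (h : F ⊆ G) (k : ℕ) : homology 𝔽 rk F k →ₗ[𝔽] homology 𝔽 rk G k :=
  (Submodule.mapQ (boundaries 𝔽 rk F k) (boundaries 𝔽 rk G k) LinearMap.id
    (boundaries_mono 𝔽 rk h k)).restrict (by
      rintro _ ⟨c, hc, rfl⟩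
      exact ⟨c, cycles_mono 𝔽 rk h k hc, rfl⟩)

/-- Points of `ℝ^d`. -/
abbrev Pt (d : ℕ) : Type := EuclideanSpace ℝ (Fin d)

/-- Unit directions in `ℝ^d`. -/
abbrev Dir (d : ℕ) : Type := Metric.sphere (0 : Pt d) 1

/-- The lower-star filter function: `h_s(σ)` is the maximum of `s · v` over the vertices `v` of
`σ`. -/
noncomputable def lowerStar {d : ℕ} (s : Dir d) (σ : Finset (Pt d)) : ℝ :=
  if h : σ.Nonempty then σ.sup' h fun v => inner ℝ (s : Pt d) v else 0

/-- `idx` is an index filtration of the finite complex `K` compatible with the filter `f`: it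
numbers the simplices `1, …, n`, each simplex after its proper faces, in an order refining `f`. -/
structure IsIndexFiltration {d : ℕ} (K : Geometry.SimplicialComplex ℝ (Pt d))
    (f : Finset (Pt d) → ℝ) (idx : Finset (Pt d) → ℕ) : Prop where
  bijOn : Set.BijOn idx K.faces (Set.Icc 1 K.faces.ncard)
  face_lt : ∀ σ ∈ K.faces, ∀ τ ∈ K.faces, σ ⊂ τ → idx σ < idx τ
  compatible : ∀ σ ∈ K.faces, ∀ τ ∈ K.faces, f σ < f τ → idx σ < idx τ

/-- The `i`-th complex of the index filtration. -/
def stage {d : ℕ} (K : Geometry.SimplicialComplex ℝ (Pt d)) (idx : Finset (Pt d) → ℕ) (i : ℕ) :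
    Set (Finset (Pt d)) :=
  {σ | σ ∈ K.faces ∧ idx σ ≤ i}

theorem stage_mono {d : ℕ} (K : Geometry.SimplicialComplex ℝ (Pt d)) (idx : Finset (Pt d) → ℕ)
    {i j : ℕ} (h : i ≤ j) : stage K idx i ⊆ stage K idx j :=
  fun _ hσ => ⟨hσ.1, hσ.2.trans h⟩

/-- The persistent Betti number `β_k^{i,j}`, the rank of `H_k(F_i) → H_k(F_j)` (for `i ≤ j`).
The vertices are ordered by their indices. -/
noncomputable def persistentBetti {d : ℕ} (𝔽 : Type*) [Field 𝔽]
    (K : Geometry.SimplicialComplex ℝ (Pt d)) (idx : Finset (Pt d) → ℕ) (k i j : ℕ) : ℕ :=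
  if h : i ≤ j then
    Module.finrank 𝔽 (LinearMap.range
      (homologyMap 𝔽 (fun v => idx {v}) (stage_mono K idx h) k))
  else 0

/-- Multiplicity of the point `(i, j)`, `i < j`, in the `k`-th persistence diagram of the index
filtration. -/
noncomputable def pairMultiplicity {d : ℕ} (𝔽 : Type*) [Field 𝔽]
    (K : Geometry.SimplicialComplex ℝ (Pt d)) (idx : Finset (Pt d) → ℕ) (k i j : ℕ) : ℕ :=
  ((persistentBetti 𝔽 K idx k i (j - 1) : ℤ) - persistentBetti 𝔽 K idx k i j
    - persistentBetti 𝔽 K idx k (i - 1) (j - 1) + persistentBetti 𝔽 K idx k (i - 1) j).toNat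

/-- Multiplicity of the point `(i, ∞)`: classes born at `i` that never die. -/
noncomputable def essentialMultiplicity {d : ℕ} (𝔽 : Type*) [Field 𝔽]
    (K : Geometry.SimplicialComplex ℝ (Pt d)) (idx : Finset (Pt d) → ℕ) (k i : ℕ) : ℕ :=
  ((persistentBetti 𝔽 K idx k i K.faces.ncard : ℤ)
    - persistentBetti 𝔽 K idx k (i - 1) K.faces.ncard).toNat

/-- The `k`-dimensional augmented persistence diagram of `f` computed from the index filtration
`idx`: a point `(f σ, f τ)` for every point `(idx σ, idx τ)`, and a point `(f σ, ∞)` for every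
point `(idx σ, ∞)`, of the persistence diagram of the index filtration. -/
noncomputable def augmentedDiagram {d : ℕ} (𝔽 : Type*) [Field 𝔽]
    (K : Geometry.SimplicialComplex ℝ (Pt d)) (hK : K.faces.Finite) (f : Finset (Pt d) → ℝ)
    (idx : Finset (Pt d) → ℕ) (k : ℕ) : Multiset (ℝ × EReal) :=
  (∑ σ ∈ hK.toFinset, ∑ τ ∈ hK.toFinset with idx σ < idx τ,
      Multiset.replicate (pairMultiplicity 𝔽 K idx k (idx σ) (idx τ)) (f σ, (f τ : EReal)))
    + ∑ σ ∈ hK.toFinset,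
      Multiset.replicate (essentialMultiplicity 𝔽 K idx k (idx σ)) (f σ, (⊤ : EReal))

/-- What an oracle call returns: for each dimension, the list of points (birth, death). -/
abbrev Diagram : Type := ℕ → List (ℝ × EReal)

/-- `O` is an oracle for `K`: in every direction `s` it returns the augmented persistence diagram
of the lower-star filtration of `K` (the points listed in any order, computed with any compatible
index filtration). -/
def IsOracle {d : ℕ} (𝔽 : Type*) [Field 𝔽] (K : Geometry.SimplicialComplex ℝ (Pt d))
    (hK : K.faces.Finite) (O : Dir d → Diagram) : Prop :=
  ∀ s : Dir d, ∃ idx : Finset (Pt d) → ℕ, IsIndexFiltration K (lowerStar s) idx ∧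
    ∀ k : ℕ, (O s k : Multiset (ℝ × EReal)) = augmentedDiagram 𝔽 K hK (lowerStar s) idx k

/-- Programs of a real random access machine that may query an oracle for diagrams. A program
returns a value, or executes one elementary step, or asks for the diagram in a direction and
continues with the answer; it has no other access to the unknown complex. -/
inductive Prog (d : ℕ) (α : Type) : Type
  | ret (a : α) : Prog d α
  | step (p : Prog d α) : Prog d α
  | ask (s : Dir d) (next : Diagram → Prog d α) : Prog d α

namespace Prog

def bind {d : ℕ} {α β : Type} : Prog d α → (α → Prog d β) → Prog d β
  | ret a, f => f a
  | step p, f => step (p.bind f)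
  | ask s next, f => ask s fun D => (next D).bind f

instance {d : ℕ} : Monad (Prog d) where
  pure := Prog.ret
  bind := Prog.bind

/-- The value computed with the oracle `O`. -/
def run {d : ℕ} {α : Type} (O : Dir d → Diagram) : Prog d α → α
  | ret a => a
  | step p => p.run O
  | ask s next => (next (O s)).run O

/-- The running time, where one oracle query takes time `T`. -/
def time {d : ℕ} {α : Type} (O : Dir d → Diagram) (T : ℕ) : Prog d α → ℕ
  | ret _ => 0
  | step p => p.time O T + 1
  | ask s next => T + (next (O s)).time O T

/-- The number of diagrams requested. -/
def diagrams {d : ℕ} {α : Type} (O : Dir d → Diagram) : Prog d α → ℕ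
  | ret _ => 0
  | step p => p.diagrams O
  | ask s next => 1 + (next (O s)).diagrams O

/-- One elementary step: a comparison, an arithmetic or trigonometric expression of constant size
in coordinates and registers, or a list operation at the head of a list. -/
def op {d : ℕ} {α : Type} (a : α) : Prog d α := step (ret a)

/-- Spend `n` steps. -/
def spend {d : ℕ} : ℕ → Prog d Unit
  | 0 => ret ()
  | n + 1 => step (spend n)

/-- Request the diagram in direction `s`. -/
def query {d : ℕ} (s : Dir d) : Prog d Diagram := ask s ret

/-- The sublist of the elements with property `p` (each tested in one step), order kept. -/
noncomputable def select {d : ℕ} {α : Type} (p : α → Prop) : List α → Prog d (List α)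
  | [] => op []
  | a :: l => do
      let keep ← op (Classical.propDecidable (p a)).decide
      let rest ← select p l
      return if keep then a :: rest else rest

/-- The number of elements with property `p`. -/
noncomputable def count {d : ℕ} {α : Type} (p : α → Prop) : List α → Prog d ℕ
  | [] => op 0
  | a :: l => do
      let hit ← op (Classical.propDecidable (p a)).decide
      let rest ← count p l
      return if hit then rest + 1 else rest

/-- The list of the values `g a`, each computed in one step. -/
def mapList {d : ℕ} {α β : Type} (g : α → β) : List α → Prog d (List β)
  | [] => op []
  | a :: l => do
      let x ← op (g a)
      let rest ← mapList g l
      return x :: rest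

/-- Merge two lists that are sorted by increasing key. -/
noncomputable def merge {d : ℕ} {α : Type} (key : α → ℝ) : List α → List α → Prog d (List α)
  | [], l => op l
  | l, [] => op l
  | a :: l, b :: m => do
      let c ← op (Real.decidableLE (key a) (key b)).decide
      if c then
        let rest ← merge key l (b :: m)
        return a :: rest
      else
        let rest ← merge key (a :: l) m
        return b :: rest
  termination_by l m => l.length + m.length

/-- Merge sort by increasing key; walking to the middle of the list costs its length. -/
noncomputable def mergeSort {d : ℕ} {α : Type} (key : α → ℝ) (l : List α) : Prog d (List α) :=
  if 2 ≤ l.length then do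
    spend l.length
    let left ← mergeSort key (l.take (l.length / 2))
    let right ← mergeSort key (l.drop (l.length / 2))
    merge key left right
  else op l
  termination_by l.length
  decreasing_by
    all_goals simp only [List.length_take, List.length_drop]; omega

end Prog

/-- An orthonormal pair `b₁, b₂` in `ℝ^d`: the sweep direction and the second direction spanning
the plane in which vertices are sorted radially. -/
structure Frame (d : ℕ) where
  b₁ : Pt d
  b₂ : Pt d
  norm_b₁ : ‖b₁‖ = 1
  norm_b₂ : ‖b₂‖ = 1
  orthogonal : inner ℝ b₁ b₂ = 0

namespace Frame

/-- First coordinate of a point; "above" and "below" refer to it. -/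
noncomputable def x₁ {d : ℕ} (b : Frame d) (v : Pt d) : ℝ := inner ℝ b.b₁ v

/-- Second coordinate of a point. -/
noncomputable def x₂ {d : ℕ} (b : Frame d) (v : Pt d) : ℝ := inner ℝ b.b₂ v

/-- The orthogonal projection to the plane, in coordinates. -/
noncomputable def proj {d : ℕ} (b : Frame d) (v : Pt d) : EuclideanSpace ℝ (Fin 2) :=
  !₂[b.x₁ v, b.x₂ v]

/-- The unit direction of the plane at angle `φ` from `b₂` towards `b₁`. -/
noncomputable def dir {d : ℕ} (b : Frame d) (φ : ℝ) : Dir d :=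
  ⟨Real.cos φ • b.b₂ + Real.sin φ • b.b₁, by
    have h : ‖Real.cos φ • b.b₂ + Real.sin φ • b.b₁‖ ^ 2 = 1 := by
      rw [norm_add_sq_real, norm_smul, norm_smul, b.norm_b₁, b.norm_b₂, inner_smul_left,
        inner_smul_right, real_inner_comm, b.orthogonal]
      simp
    have h0 := norm_nonneg (Real.cos φ • b.b₂ + Real.sin φ • b.b₁)
    rw [mem_sphere_zero_iff_norm]
    nlinarith⟩

/-- The direction `-b₁`. -/
noncomputable def negDir {d : ℕ} (b : Frame d) : Dir d :=
  ⟨-b.b₁, by rw [mem_sphere_zero_iff_norm, norm_neg, b.norm_b₁]⟩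

/-- The height of `v` in the direction `b.dir φ`, from its two coordinates. -/
noncomputable def height {d : ℕ} (b : Frame d) (φ : ℝ) (v : Pt d) : ℝ :=
  Real.cos φ * b.x₂ v + Real.sin φ * b.x₁ v

/-- The angle in `(0, π)`, measured from `b₂`, of the line through the projections of `v` and `u`
(which have different `x₁`). For `u` above `v` it is the angle of the ray from `v` to `u`. -/
noncomputable def angle {d : ℕ} (b : Frame d) (v u : Pt d) : ℝ :=
  Real.pi / 2 - Real.arctan ((b.x₂ u - b.x₂ v) / (b.x₁ u - b.x₁ v))

end Frame

/-- The `1`-indegree of a vertex, read off the diagram `D` in a direction in which that vertex is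
the only one of height `c`: the deaths at `c` in dimension `0` plus the births at `c` in dimension
`1`. -/
noncomputable def indegree {d : ℕ} (D : Diagram) (c : ℝ) : Prog d ℕ := do
  let deaths ← Prog.count (fun p => p.2 = (c : EReal)) (D 0)
  let births ← Prog.count (fun p => p.1 = c) (D 1)
  Prog.op (deaths + births)

/-- For angles `prev :: l` in decreasing order: the smallest difference between consecutive angles,
where the last angle is followed by `first - π` (angles of lines are periodic mod `π`). -/
noncomputable def minGap {d : ℕ} (first : ℝ) : ℝ → List ℝ → Prog d ℝ
  | prev, [] => Prog.op (prev - (first - Real.pi))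
  | prev, a :: l => do
      let g ← minGap first a l
      Prog.op (min (prev - a) g)

/-- The smallest angle between two lines joining a fixed vertex to other vertices, from the list of
the decreasingly sorted angles of these lines. -/
noncomputable def minAngle {d : ℕ} : List ℝ → Prog d ℝ
  | [] => Prog.op Real.pi
  | a :: l => minGap a a l

/-- An edge interval around a vertex `v`: a list of consecutive vertices above `v`, sorted clockwise
around `v`, and the number of them that are joined to `v` by an edge. -/
structure EdgeInterval (d : ℕ) where
  verts : List (Pt d)
  count : ℕ

/-- The edge count of the left half `left` of an edge interval around `v`, where `known` lists the
neighbours of `v` that are below `v` or to the left of the interval. One diagram is requested, in a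
direction such that exactly the vertices of `left` and those before them are below `v` among the
vertices that are above `v` with respect to `b₁`: the direction perpendicular to the ray from `v`
to the last vertex of `left`, turned by half of the minimum angle `θ`. -/
noncomputable def leftCount {d : ℕ} (b : Frame d) (v : Pt d) (θ : ℝ) (left known : List (Pt d)) :
    Prog d ℕ := do
  Prog.spend left.length
  let φ ← Prog.op (b.angle v (left.getLastD v) - Real.pi / 2 - θ / 2)
  let D ← Prog.query (b.dir φ)
  let c ← Prog.op (b.height φ v)
  let i ← indegree D c
  let j ← Prog.count (fun u => b.height φ u < c) known
  Prog.op (i - j)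

/-- The binary search around `v`, with a stack of edge intervals. An interval without edges is
dropped, the vertex of a one-vertex interval is a neighbour, and any other interval is split into
two halves, of which the left one is processed first. -/
noncomputable def search {d : ℕ} (b : Frame d) (v : Pt d) (θ : ℝ) :
    List (EdgeInterval d) → List (Pt d) → Prog d (List (Pt d))
  | [], known => Prog.op known
  | I :: stack, known => do
      Prog.spend 1
      if I.count = 0 then
        search b v θ stack known
      else if I.verts.length < 2 then
        search b v θ stack (I.verts ++ known)
      else
        Prog.spend I.verts.length
        let c ← leftCount b v θ (I.verts.take (I.verts.length / 2)) known
        search b v θ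
          (⟨I.verts.take (I.verts.length / 2), c⟩ ::
            ⟨I.verts.drop (I.verts.length / 2), I.count - c⟩ :: stack) known
  termination_by stack _ => (stack.map fun I => I.verts.length ^ 2 + 1).sum
  decreasing_by
    · simp
    · simp
    · rename_i hlen
      simp only [List.map_cons, List.sum_cons, List.length_take, List.length_drop]
      obtain ⟨p, q, hp, hq, hpq, h1, h2⟩ : ∃ p q : ℕ, 1 ≤ p ∧ 1 ≤ q ∧ I.verts.length = p + q ∧
          min (I.verts.length / 2) I.verts.length = p ∧
          I.verts.length - I.verts.length / 2 = q :=
        ⟨I.verts.length / 2, I.verts.length - I.verts.length / 2, by omega, by omega, by omega,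
          by omega, rfl⟩
      rw [h1, h2, hpq]
      nlinarith [Nat.mul_le_mul hp hq]

/-- All neighbours of `v` above `v`, given the list `V` of all vertices, the diagram `D` in direction
`-b₁`, and the list `below` of the neighbours of `v` below `v`. The radial sorting is done only if
there is something to find. -/
noncomputable def upEdges {d : ℕ} (b : Frame d) (V : List (Pt d)) (D : Diagram) (v : Pt d)
    (below : List (Pt d)) : Prog d (List (Pt d)) := do
  let c ← indegree D (-b.x₁ v)
  if c = 0 then
    Prog.op []
  else
    let others ← Prog.select (fun u => b.x₁ u ≠ b.x₁ v) V
    let sorted ← Prog.mergeSort (fun u => -b.angle v u) others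
    let angles ← Prog.mapList (b.angle v) sorted
    let θ ← minAngle angles
    let above ← Prog.select (fun u => b.x₁ v < b.x₁ u) sorted
    let nbrs ← search b v θ [⟨above, c⟩] below
    Prog.select (fun u => b.x₁ v < b.x₁ u) nbrs

/-- The sweep over the vertices in the order of the first list; `edges` holds the edges found so
far, as pairs (lower vertex, upper vertex). -/
noncomputable def sweep {d : ℕ} (b : Frame d) (V : List (Pt d)) (D : Diagram) :
    List (Pt d) → List (Pt d × Pt d) → Prog d (List (Pt d × Pt d))
  | [], edges => Prog.op edges
  | v :: rest, edges => do
      let incoming ← Prog.select (fun e => b.x₁ e.2 = b.x₁ v) edges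
      let below ← Prog.mapList Prod.fst incoming
      let up ← upEdges b V D v below
      let new ← Prog.mapList (fun u => (v, u)) up
      Prog.spend new.length
      sweep b V D rest (new ++ edges)

/-- The algorithm find-edges: from the list `V` of the vertex locations it computes the list of the
edges, by a sweep in direction `b₁`. -/
noncomputable def findEdges {d : ℕ} (b : Frame d) (V : List (Pt d)) :
    Prog d (List (Pt d × Pt d)) := do
  let D ← Prog.query b.negDir
  let sorted ← Prog.mergeSort b.x₁ V
  sweep b V D sorted []

open scoped Classical in
/-- The edge (as a vertex set) given by a pair of endpoints. -/
noncomputable def edgeOf {d : ℕ} (e : Pt d × Pt d) : Finset (Pt d) := {e.1, e.2}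

/-- The set of edges (one-simplices) of `K`. -/
def edgeSet {d : ℕ} (K : Geometry.SimplicialComplex ℝ (Pt d)) : Set (Finset (Pt d)) :=
  {σ | σ ∈ K.faces ∧ σ.card = 2}

/-! The bridge from persistence to edges is rank-nullity. Inserting a simplex τ into an index
filtration changes `dim B₀ + dim Z₁` by as much as it changes `dim C₁`, hence by one if τ is an edge
and by zero otherwise. Telescoping the persistent Betti numbers shows that the dimension-0 deaths at
τ count the increase of `dim B₀`, and the dimension-1 births at τ the increase of `dim Z₁`
(`deaths_add_births`). Diagonal points belong to the augmented diagram, so nothing is lost in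
passing to heights: deaths plus births at height c count the edges whose higher endpoint has height
c. If v is the only vertex at that height, this is the number of neighbours below v
(`run_indegree_eq_length`).

In direction `-b₁` this number is the count of upward edges at v. In the tilted direction of a
split, a vertex above v with respect to `b₁` is lower than v exactly if its angle is at least that
of the last vertex of the left half; no other vertex is level with v, because the tilt `θ/2` is less
than the least angle between two lines (`IsSeparating.height_lt_iff`, `IsSeparating.height_ne`).
Removing the known neighbours on the lower side leaves the edges into the left half
(`run_leftCount`), so the binary search is correct.

The cost is governed by the potential `count * clog 2 length`. A split needs one diagram, and both
halves have ceiling logarithm at most one less than the whole; since the count is positive, the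
potential drops by at least one (`search_spec`). Summed over the sweep this gives at most `1 + n₁ *
clog 2 n₀` diagrams. For the time, a split costs `O(n₀ + n₁)` steps besides the query, and radial
sorting is done only at vertices with an upward edge, so its `O(n₀²)` steps are charged to that
edge. The bounds `n₁ ≤ n₀²`, and `n₀ ≥ 2` whenever there is an edge, turn this into the stated form.
-/

/-! ### Values, times and query counts of the basic programs -/

namespace Prog

variable {d : ℕ} {α β : Type} (O : Dir d → Diagram) (T : ℕ)

@[simp] theorem run_pure (a : α) : (pure a : Prog d α).run O = a := rfl

@[simp] theorem time_pure (a : α) : (pure a : Prog d α).time O T = 0 := rfl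

@[simp] theorem diagrams_pure (a : α) : (pure a : Prog d α).diagrams O = 0 := rfl

@[simp] theorem run_bind (p : Prog d α) (f : α → Prog d β) :
    (p >>= f).run O = (f (p.run O)).run O := by
  change (p.bind f).run O = _
  induction p with
  | ret a => rfl
  | step p ih => exact ih
  | ask s next ih => exact ih (O s)

@[simp] theorem time_bind (p : Prog d α) (f : α → Prog d β) :
    (p >>= f).time O T = p.time O T + (f (p.run O)).time O T := by
  change (p.bind f).time O T = _
  induction p with
  | ret a => simp [bind, time, run]
  | step p ih => simp only [bind, time, run, ih]; omega
  | ask s next ih => simp only [bind, time, run, ih]; omega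

@[simp] theorem diagrams_bind (p : Prog d α) (f : α → Prog d β) :
    (p >>= f).diagrams O = p.diagrams O + (f (p.run O)).diagrams O := by
  change (p.bind f).diagrams O = _
  induction p with
  | ret a => simp [bind, diagrams, run]
  | step p ih => simp only [bind, diagrams, run, ih]
  | ask s next ih => simp only [bind, diagrams, run, ih]; omega

/-- The running time splits into the time spent in queries and the remaining steps. -/
theorem time_eq (p : Prog d α) : p.time O T = T * p.diagrams O + p.time O 0 := by
  induction p with
  | ret a => simp [time, diagrams]
  | step p ih => simp only [time, diagrams, ih]; omega
  | ask s next ih => simp only [time, diagrams, ih]; ring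

@[simp] theorem run_op (a : α) : (op a : Prog d α).run O = a := rfl

@[simp] theorem time_op (a : α) : (op a : Prog d α).time O T = 1 := rfl

@[simp] theorem diagrams_op (a : α) : (op a : Prog d α).diagrams O = 0 := rfl

@[simp] theorem run_query (s : Dir d) : (query s).run O = O s := rfl

@[simp] theorem time_query (s : Dir d) : (query s).time O T = T := rfl

@[simp] theorem diagrams_query (s : Dir d) : (query s).diagrams O = 1 := rfl

@[simp] theorem time_spend (n : ℕ) : (spend n : Prog d Unit).time O T = n := by
  induction n with
  | zero => rfl
  | succ n ih => simp [spend, time, ih]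

@[simp] theorem diagrams_spend (n : ℕ) : (spend n : Prog d Unit).diagrams O = 0 := by
  induction n with
  | zero => rfl
  | succ n ih => simp [spend, diagrams, ih]

@[simp] theorem run_select (p : α → Prop) [DecidablePred p] (l : List α) :
    (select p l : Prog d _).run O = l.filter fun a => decide (p a) := by
  induction l with
  | nil => rfl
  | cons a l ih => by_cases h : p a <;> simp [select, ih, h]

@[simp] theorem time_select (p : α → Prop) (l : List α) :
    (select p l : Prog d _).time O T = l.length + 1 := by
  induction l with
  | nil => rfl
  | cons a l ih => simp [select, ih]; omega

@[simp] theorem diagrams_select (p : α → Prop) (l : List α) :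
    (select p l : Prog d _).diagrams O = 0 := by
  induction l with
  | nil => rfl
  | cons a l ih => simp [select, ih]

@[simp] theorem run_count (p : α → Prop) [DecidablePred p] (l : List α) :
    (count p l : Prog d _).run O = l.countP fun a => decide (p a) := by
  induction l with
  | nil => rfl
  | cons a l ih => by_cases h : p a <;> simp [count, ih, h]

@[simp] theorem time_count (p : α → Prop) (l : List α) :
    (count p l : Prog d _).time O T = l.length + 1 := by
  induction l with
  | nil => rfl
  | cons a l ih => simp [count, ih]; omega

@[simp] theorem diagrams_count (p : α → Prop) (l : List α) :
    (count p l : Prog d _).diagrams O = 0 := by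
  induction l with
  | nil => rfl
  | cons a l ih => simp [count, ih]

@[simp] theorem run_mapList (g : α → β) (l : List α) :
    (mapList g l : Prog d _).run O = l.map g := by
  induction l with
  | nil => rfl
  | cons a l ih => simp [mapList, ih]

@[simp] theorem time_mapList (g : α → β) (l : List α) :
    (mapList g l : Prog d _).time O T = l.length + 1 := by
  induction l with
  | nil => rfl
  | cons a l ih => simp [mapList, ih]; omega

@[simp] theorem diagrams_mapList (g : α → β) (l : List α) :
    (mapList g l : Prog d _).diagrams O = 0 := by
  induction l with
  | nil => rfl
  | cons a l ih => simp [mapList, ih]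

theorem merge_spec (key : α → ℝ) (l m : List α) :
    (merge key l m : Prog d _).diagrams O = 0 ∧
    (merge key l m : Prog d _).time O T ≤ l.length + m.length + 1 ∧
    ((merge key l m : Prog d _).run O).Perm (l ++ m) ∧
    (l.Pairwise (fun x y => key x ≤ key y) → m.Pairwise (fun x y => key x ≤ key y) →
      ((merge key l m : Prog d _).run O).Pairwise fun x y => key x ≤ key y) := by
  fun_induction merge (d := d) key l m with
  | case1 l => simp
  | case2 l => simp
  | case3 a l b m ih1 ih2 =>
    obtain ⟨q1, t1, p1, s1⟩ := ih1
    obtain ⟨q2, t2, p2, s2⟩ := ih2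
    by_cases h : key a ≤ key b
    · simp only [diagrams_bind, time_bind, run_bind, diagrams_op, time_op, run_op, h, decide_true,
        if_true, diagrams_pure, time_pure, run_pure, List.length_cons, List.cons_append]
      refine ⟨by omega, by simp only [List.length_cons] at t1; omega, p1.cons a, fun hl hm => ?_⟩
      refine List.pairwise_cons.2 ⟨fun x hx => ?_, s1 (List.pairwise_cons.1 hl).2 hm⟩
      rcases List.mem_append.1 (p1.mem_iff.1 hx) with hx | hx
      · exact (List.pairwise_cons.1 hl).1 x hx
      · rcases List.mem_cons.1 hx with rfl | hx
        · exact h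
        · exact h.trans ((List.pairwise_cons.1 hm).1 x hx)
    · simp only [diagrams_bind, time_bind, run_bind, diagrams_op, time_op, run_op, h, decide_false,
        Bool.false_eq_true, if_false, diagrams_pure, time_pure, run_pure, List.length_cons]
      refine ⟨by omega, by simp only [List.length_cons] at t2; omega,
        (p2.cons b).trans List.perm_middle.symm, fun hl hm => ?_⟩
      refine List.pairwise_cons.2 ⟨fun x hx => ?_, s2 hl (List.pairwise_cons.1 hm).2⟩
      rcases List.mem_append.1 (p2.mem_iff.1 hx) with hx | hx
      · rcases List.mem_cons.1 hx with rfl | hx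
        · exact (not_le.1 h).le
        · exact (not_le.1 h).le.trans ((List.pairwise_cons.1 hl).1 x hx)
      · exact (List.pairwise_cons.1 hm).1 x hx

/-- A quadratic time bound is enough here, since the final estimate allows `n₀²` per edge anyway. -/
theorem mergeSort_spec (key : α → ℝ) (l : List α) :
    (mergeSort key l : Prog d _).diagrams O = 0 ∧
    (mergeSort key l : Prog d _).time O T ≤ 4 * l.length ^ 2 + 1 ∧
    ((mergeSort key l : Prog d _).run O).Perm l ∧
    ((mergeSort key l : Prog d _).run O).Pairwise fun x y => key x ≤ key y := by
  fun_induction mergeSort (d := d) key l with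
  | case1 l h ih1 ih2 =>
    obtain ⟨q1, t1, p1, s1⟩ := ih1
    obtain ⟨q2, t2, p2, s2⟩ := ih2
    obtain ⟨q, t, p, s⟩ := merge_spec O T key ((mergeSort key (l.take (l.length / 2))).run O)
      ((mergeSort key (l.drop (l.length / 2))).run O)
    simp only [diagrams_bind, time_bind, run_bind, diagrams_spend, time_spend]
    refine ⟨by omega, ?_, ?_, s s1 s2⟩
    · rw [p1.length_eq, p2.length_eq] at t
      simp only [List.length_take, List.length_drop] at t t1 t2
      obtain ⟨p, q, hp, hq, hpq, h1, h2⟩ : ∃ p q : ℕ, 1 ≤ p ∧ 1 ≤ q ∧ l.length = p + q ∧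
          min (l.length / 2) l.length = p ∧ l.length - l.length / 2 = q :=
        ⟨l.length / 2, l.length - l.length / 2, by omega, by omega, by omega, by omega, rfl⟩
      rw [h1, h2] at t
      rw [h1] at t1
      rw [h2] at t2
      have h3 : l.length ^ 2 = (p + q) ^ 2 := by rw [hpq]
      rw [h3]
      clear h3 h1 h2
      -- With both halves of size at least one, the cross term `8pq` of `4(p+q)²` pays for walking
      -- to the middle and for merging.
      obtain ⟨p, rfl⟩ := Nat.exists_eq_add_of_le hp
      obtain ⟨q, rfl⟩ := Nat.exists_eq_add_of_le hq
      have : 0 ≤ p * q := Nat.zero_le _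
      nlinarith
    · refine p.trans ((p1.append p2).trans ?_)
      rw [List.take_append_drop]
  | case2 l h =>
    refine ⟨rfl, by simp, List.Perm.refl _, ?_⟩
    match l, h with
    | [], _ => simp
    | [a], _ => simp
    | a :: b :: l, h => simp at h

end Prog

/-! ### The minimum angle between lines -/

theorem time_minGap {d : ℕ} (O : Dir d → Diagram) (T : ℕ) (first a : ℝ) (l : List ℝ) :
    (minGap (d := d) first a l).time O T = l.length + 1 := by
  induction l generalizing a with
  | nil => rfl
  | cons x l ih => simp [minGap, ih]

theorem diagrams_minGap {d : ℕ} (O : Dir d → Diagram) (first a : ℝ) (l : List ℝ) :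
    (minGap (d := d) first a l).diagrams O = 0 := by
  induction l generalizing a with
  | nil => rfl
  | cons x l ih => simp [minGap, ih]

theorem time_minAngle {d : ℕ} (O : Dir d → Diagram) (T : ℕ) (l : List ℝ) :
    (minAngle (d := d) l).time O T ≤ l.length + 1 := by
  cases l with
  | nil => simp [minAngle]
  | cons a l => simp [minAngle, time_minGap]

theorem diagrams_minAngle {d : ℕ} (O : Dir d → Diagram) (l : List ℝ) :
    (minAngle (d := d) l).diagrams O = 0 := by
  cases l with
  | nil => rfl
  | cons a l => exact diagrams_minGap O a a l

/-- The gap computed by `minGap` separates consecutive angles, and also the last angle from the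
first one shifted by `π`. -/
theorem run_minGap {d : ℕ} (O : Dir d → Diagram) (first a : ℝ) (l : List ℝ)
    (hl : (a :: l).Pairwise (· > ·)) (hpi : ∀ x ∈ a :: l, first - Real.pi < x) :
    0 < (minGap (d := d) first a l).run O ∧
    (a :: l).Pairwise (fun x y => y + (minGap (d := d) first a l).run O ≤ x) ∧
    ∀ x ∈ a :: l, first - Real.pi + (minGap (d := d) first a l).run O ≤ x := by
  induction l generalizing a with
  | nil =>
    have := hpi a (by simp)
    simp only [minGap, Prog.run_op]
    refine ⟨by linarith, by simp, by simp⟩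
  | cons b l ih =>
    obtain ⟨h0, h1, h2⟩ := ih b (List.pairwise_cons.1 hl).2
      fun x hx => hpi x (List.mem_cons_of_mem _ hx)
    have hab : b < a := (List.pairwise_cons.1 hl).1 b (by simp)
    simp only [minGap, Prog.run_bind, Prog.run_op]
    set g := (minGap (d := d) first b l).run O
    have hg : min (a - b) g ≤ g := min_le_right _ _
    have hg' : min (a - b) g ≤ a - b := min_le_left _ _
    refine ⟨lt_min (by linarith) h0, List.pairwise_cons.2 ⟨fun x hx => ?_,
      h1.imp fun h => by linarith⟩, fun x hx => ?_⟩
    · rcases List.mem_cons.1 hx with rfl | hx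
      · linarith
      · have := (List.pairwise_cons.1 h1).1 x hx
        linarith
    · rcases List.mem_cons.1 hx with rfl | hx
      · have := h2 b (by simp)
        linarith
      · have := h2 x hx
        linarith

/-- The angle `θ` computed by `minAngle` is a lower bound for the angles between two of the lines,
measured on both sides. -/
theorem run_minAngle {d : ℕ} (O : Dir d → Diagram) (l : List ℝ) (hl : l.Pairwise (· > ·))
    (hpi : ∀ x ∈ l, 0 < x ∧ x < Real.pi) :
    0 < (minAngle (d := d) l).run O ∧
    (∀ x ∈ l, ∀ y ∈ l, y < x → y + (minAngle (d := d) l).run O ≤ x) ∧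
    ∀ x ∈ l, ∀ y ∈ l, x - Real.pi + (minAngle (d := d) l).run O ≤ y := by
  cases l with
  | nil => simp [minAngle, Real.pi_pos]
  | cons a l =>
    obtain ⟨h0, h1, h2⟩ := run_minGap O a a l hl fun x hx => by
      linarith [(hpi x hx).1, (hpi a (by simp)).2]
    simp only [minAngle]
    set g := (minGap (d := d) a a l).run O
    refine ⟨h0, fun x hx y hy hxy => ?_, fun x hx y hy => ?_⟩
    -- In a strictly decreasing list, `y < x` forces `x` to come before `y`, so the positional gap
    -- applies to the pair.
    · have key : ∀ l : List ℝ, l.Pairwise (· > ·) → l.Pairwise (fun x y => y + g ≤ x) →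
          ∀ x ∈ l, ∀ y ∈ l, y < x → y + g ≤ x := by
        intro l hl hg
        have := hl.and hg
        induction l with
        | nil => simp
        | cons b l ih =>
          have h3 := List.pairwise_cons.1 this
          intro x hx y hy hxy
          rcases List.mem_cons.1 hx with rfl | hx'
          · rcases List.mem_cons.1 hy with rfl | hy'
            · exact absurd hxy (lt_irrefl _)
            · exact (h3.1 y hy').2
          · rcases List.mem_cons.1 hy with rfl | hy'
            · exact absurd hxy (not_lt.2 (h3.1 x hx').1.le)
            · exact ih (List.pairwise_cons.1 hl).2 (List.pairwise_cons.1 hg).2 h3.2 x hx' y hy' hxy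
      exact key _ hl h1 x hx y hy hxy
    -- The wrap-around bound is known only for the largest angle `a`; it is weaker for every smaller
    -- one.
    · have hxa : x ≤ a := by
        rcases List.mem_cons.1 hx with rfl | hx
        · exact le_rfl
        · exact ((List.pairwise_cons.1 hl).1 x hx).le
      have := h2 y hy
      linarith

/-! ### Dimension counts for subspaces -/

section LinearAlgebra

variable {𝔽 V W : Type*} [Field 𝔽] [AddCommGroup V] [Module 𝔽 V] [AddCommGroup W] [Module 𝔽 W]

open Module in
theorem finrank_map_add_finrank_inf_ker (f : V →ₗ[𝔽] W) (p : Submodule 𝔽 V)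
    [FiniteDimensional 𝔽 p] :
    finrank 𝔽 (p.map f) + finrank 𝔽 (p ⊓ LinearMap.ker f : Submodule 𝔽 V) = finrank 𝔽 p := by
  have h := LinearMap.finrank_range_add_finrank_ker (f.domRestrict p)
  rw [LinearMap.range_domRestrict, LinearMap.ker_domRestrict,
    ← Submodule.finrank_map_subtype_eq p, Submodule.map_comap_subtype] at h
  exact h

-- The subspaces `A ⊓ B'` and `A' ⊓ B` both lie in `A' ⊓ B'` and meet in `A ⊓ B`. Applied to cycles
-- and boundaries, this is the nonnegativity of pair multiplicities.
open Module in
theorem finrank_inf_add_finrank_inf_le {A A' B B' : Submodule 𝔽 V} (hA : A ≤ A') (hB : B ≤ B')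
    [FiniteDimensional 𝔽 A'] :
    finrank 𝔽 (A ⊓ B' : Submodule 𝔽 V) + finrank 𝔽 (A' ⊓ B : Submodule 𝔽 V) ≤
      finrank 𝔽 (A' ⊓ B' : Submodule 𝔽 V) + finrank 𝔽 (A ⊓ B : Submodule 𝔽 V) := by
  have : FiniteDimensional 𝔽 (A ⊓ B' : Submodule 𝔽 V) :=
    Submodule.finiteDimensional_of_le (inf_le_left.trans hA)
  have : FiniteDimensional 𝔽 (A' ⊓ B : Submodule 𝔽 V) :=
    Submodule.finiteDimensional_of_le inf_le_left
  have : FiniteDimensional 𝔽 (A' ⊓ B' : Submodule 𝔽 V) :=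
    Submodule.finiteDimensional_of_le inf_le_left
  rw [← Submodule.finrank_sup_add_finrank_inf_eq]
  have h1 : (A ⊓ B') ⊓ (A' ⊓ B) = A ⊓ B := by
    rw [inf_inf_inf_comm, inf_eq_left.2 hA, inf_eq_right.2 hB]
  have h2 : (A ⊓ B') ⊔ (A' ⊓ B) ≤ A' ⊓ B' :=
    sup_le (inf_le_inf_right _ hA) (inf_le_inf_left _ hB)
  rw [h1]
  exact Nat.add_le_add_right (Submodule.finrank_mono h2) _

end LinearAlgebra

/-! ### Dimensions of chains, cycles and induced maps on homology -/

section Chains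

variable {E : Type*} (𝔽 : Type*) [Field 𝔽] (rk : E → ℕ) {F G : Set (Finset E)}

theorem finrank_chains (hF : F.Finite) (k : ℕ) :
    Module.finrank 𝔽 (chains 𝔽 F k) = {σ | σ ∈ F ∧ σ.card = k + 1}.ncard := by
  have hfin : {σ | σ ∈ F ∧ σ.card = k + 1}.Finite := hF.subset fun σ hσ => hσ.1
  have := hfin.fintype
  rw [chains, (Finsupp.supportedEquivFinsupp _).finrank_eq, Module.finrank_finsupp_self,
    Set.ncard_eq_toFinset_card', Set.toFinset_card]

theorem finiteDimensional_chains (hF : F.Finite) (k : ℕ) :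
    FiniteDimensional 𝔽 (chains 𝔽 F k) := by
  have hfin : {σ | σ ∈ F ∧ σ.card = k + 1}.Finite := hF.subset fun σ hσ => hσ.1
  have := hfin.fintype
  exact Module.Finite.equiv (Finsupp.supportedEquivFinsupp (M := 𝔽) (R := 𝔽)
    {σ | σ ∈ F ∧ σ.card = k + 1}).symm

theorem finiteDimensional_cycles (hF : F.Finite) (k : ℕ) :
    FiniteDimensional 𝔽 (cycles 𝔽 rk F k) := by
  have := finiteDimensional_chains 𝔽 hF k
  exact Submodule.finiteDimensional_of_le inf_le_left

theorem cycles_zero : cycles 𝔽 rk F 0 = chains 𝔽 F 0 := by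
  refine inf_eq_left.2 ?_
  rw [chains, Finsupp.supported_eq_span_single, Submodule.span_le]
  rintro _ ⟨σ, hσ, rfl⟩
  have : ¬ 2 ≤ σ.card := by rw [hσ.2]; omega
  simp [bdry, Finsupp.linearCombination_single, this]

open scoped Classical in
theorem boundaries_le_chains (hF : ∀ σ ∈ F, 2 ≤ σ.card → ∀ v ∈ σ, σ.erase v ∈ F) (k : ℕ) :
    boundaries 𝔽 rk F k ≤ chains 𝔽 F k := by
  rw [boundaries, Submodule.map_le_iff_le_comap, chains, Finsupp.supported_eq_span_single,
    Submodule.span_le]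
  rintro _ ⟨σ, hσ, rfl⟩
  have h2 : 2 ≤ σ.card := by rw [hσ.2]; omega
  simp only [bdry, Finsupp.linearCombination_single, h2, if_true, one_smul, SetLike.mem_coe,
    Submodule.mem_comap]
  refine Submodule.sum_mem _ fun v hv => ?_
  refine Finsupp.single_mem_supported 𝔽 _ ⟨?_, ?_⟩
  · convert hF σ hσ.1 h2 v hv
  · rw [Finset.card_erase_of_mem hv, hσ.2]; rfl

/-- The image of the induced map is the image of the cycles of `F` modulo the boundaries of `G`, so
rank-nullity for that quotient map applies. -/
theorem finrank_range_homologyMap (hF : F.Finite) (h : F ⊆ G) (k : ℕ) :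
    Module.finrank 𝔽 (LinearMap.range (homologyMap 𝔽 rk h k)) +
      Module.finrank 𝔽 (cycles 𝔽 rk F k ⊓ boundaries 𝔽 rk G k :
        Submodule 𝔽 (Finset E →₀ 𝔽)) = Module.finrank 𝔽 (cycles 𝔽 rk F k) := by
  have := finiteDimensional_cycles 𝔽 rk hF k
  have h1 := finrank_map_add_finrank_inf_ker (boundaries 𝔽 rk G k).mkQ (cycles 𝔽 rk F k)
  rw [Submodule.ker_mkQ] at h1
  suffices hmap : (LinearMap.range (homologyMap 𝔽 rk h k)).map (homology 𝔽 rk G k).subtype =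
      (cycles 𝔽 rk F k).map (boundaries 𝔽 rk G k).mkQ by
    rw [← h1, ← Submodule.finrank_map_subtype_eq (homology 𝔽 rk G k), hmap]
  ext x
  constructor
  · rintro ⟨_, ⟨⟨_, c, hc, rfl⟩, rfl⟩, rfl⟩
    exact ⟨c, hc, rfl⟩
  · rintro ⟨c, hc, rfl⟩
    exact ⟨_, ⟨⟨_, c, hc, rfl⟩, rfl⟩, rfl⟩

end Chains

/-! ### Births and deaths in an index filtration -/

theorem sum_Ioc_sub (g : ℕ → ℤ) {a b : ℕ} (h : a ≤ b) :
    ∑ i ∈ Finset.Ioc a b, (g i - g (i - 1)) = g b - g a := by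
  induction b, h using Nat.le_induction with
  | base => simp
  | succ b hb ih => rw [Finset.sum_Ioc_succ_top hb, ih, Nat.add_sub_cancel]; ring

section Persistence

variable {d : ℕ} (𝔽 : Type*) [Field 𝔽] {K : Geometry.SimplicialComplex ℝ (Pt d)}
  {f : Finset (Pt d) → ℝ} {idx : Finset (Pt d) → ℕ}

theorem stage_finite (hK : K.faces.Finite) (i : ℕ) : (stage K idx i).Finite :=
  hK.subset fun _ h => h.1

/-- Cycles of the `i`-th complex. -/
noncomputable abbrev stageCycles (K : Geometry.SimplicialComplex ℝ (Pt d)) (idx : Finset (Pt d) → ℕ)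
    (k i : ℕ) : Submodule 𝔽 (Finset (Pt d) →₀ 𝔽) :=
  cycles 𝔽 (fun v => idx {v}) (stage K idx i) k

/-- Boundaries of the `i`-th complex. -/
noncomputable abbrev stageBoundaries (K : Geometry.SimplicialComplex ℝ (Pt d)) (idx : Finset (Pt d) → ℕ)
    (k i : ℕ) : Submodule 𝔽 (Finset (Pt d) →₀ 𝔽) :=
  boundaries 𝔽 (fun v => idx {v}) (stage K idx i) k

theorem stageCycles_mono {i j : ℕ} (k : ℕ) (h : i ≤ j) : stageCycles 𝔽 K idx k i ≤
    stageCycles 𝔽 K idx k j :=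
  cycles_mono 𝔽 _ (stage_mono K idx h) k

theorem stageBoundaries_mono {i j : ℕ} (k : ℕ) (h : i ≤ j) : stageBoundaries 𝔽 K idx k i ≤
    stageBoundaries 𝔽 K idx k j :=
  boundaries_mono 𝔽 _ (stage_mono K idx h) k

open Module in
theorem persistentBetti_eq (hK : K.faces.Finite) (k : ℕ) {i j : ℕ} (h : i ≤ j) :
    (persistentBetti 𝔽 K idx k i j : ℤ) = finrank 𝔽 (stageCycles 𝔽 K idx k i) -
      finrank 𝔽 (stageCycles 𝔽 K idx k i ⊓ stageBoundaries 𝔽 K idx k j :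
        Submodule 𝔽 (Finset (Pt d) →₀ 𝔽)) := by
  rw [persistentBetti, dif_pos h, ← finrank_range_homologyMap 𝔽 (fun v => idx {v})
    (stage_finite hK i) (stage_mono K idx h) k]
  push_cast
  ring

-- The truncation `toNat` in the definition never acts, so multiplicities can be telescoped as
-- integers.
open Module in
theorem pairMultiplicity_eq (hK : K.faces.Finite) (k : ℕ) {i j : ℕ} (h : i < j) :
    (pairMultiplicity 𝔽 K idx k i j : ℤ) =
      (persistentBetti 𝔽 K idx k i (j - 1) - persistentBetti 𝔽 K idx k i j)
        - (persistentBetti 𝔽 K idx k (i - 1) (j - 1) - persistentBetti 𝔽 K idx k (i - 1) j) := by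
  have := finiteDimensional_cycles 𝔽 (fun v => idx {v}) (stage_finite (idx := idx) hK i) k
  have h1 := finrank_inf_add_finrank_inf_le (stageCycles_mono 𝔽 (K := K) (idx := idx) k (Nat.sub_le i 1))
    (stageBoundaries_mono 𝔽 (K := K) (idx := idx) k (Nat.sub_le j 1))
  rw [pairMultiplicity, Int.toNat_of_nonneg]
  · ring
  · rw [persistentBetti_eq 𝔽 hK k (by omega : i ≤ j - 1), persistentBetti_eq 𝔽 hK k h.le,
      persistentBetti_eq 𝔽 hK k (by omega : i - 1 ≤ j - 1),
      persistentBetti_eq 𝔽 hK k (by omega : i - 1 ≤ j)]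
    zify at h1
    linarith

-- Both ranks are dimensions of images of cycle spaces in one quotient, by the boundaries of stage
-- `j`, and the cycle spaces are nested. Hence essential multiplicities are not truncated either.
open Module in
theorem persistentBetti_mono (hK : K.faces.Finite) (k : ℕ) {i j : ℕ} (h : i ≤ j) :
    persistentBetti 𝔽 K idx k (i - 1) j ≤ persistentBetti 𝔽 K idx k i j := by
  have := finiteDimensional_cycles 𝔽 (fun v => idx {v}) (stage_finite (idx := idx) hK i) k
  have := finiteDimensional_cycles 𝔽 (fun v => idx {v}) (stage_finite (idx := idx) hK (i - 1)) k
  have e (i : ℕ) (h : i ≤ j) [FiniteDimensional 𝔽 (stageCycles 𝔽 K idx k i)] :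
      persistentBetti 𝔽 K idx k i j =
      finrank 𝔽 ((stageCycles 𝔽 K idx k i).map (stageBoundaries 𝔽 K idx k j).mkQ) := by
    have h1 := finrank_map_add_finrank_inf_ker (stageBoundaries 𝔽 K idx k j).mkQ (stageCycles 𝔽 K idx k i)
    rw [Submodule.ker_mkQ] at h1
    have h2 := persistentBetti_eq 𝔽 (idx := idx) hK k h
    omega
  rw [e i h, e (i - 1) (by omega)]
  exact Submodule.finrank_mono (Submodule.map_mono (stageCycles_mono 𝔽 k (Nat.sub_le i 1)))

theorem essentialMultiplicity_eq (hK : K.faces.Finite) (k : ℕ) {i : ℕ} (h : i ≤ K.faces.ncard) :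
    (essentialMultiplicity 𝔽 K idx k i : ℤ) = persistentBetti 𝔽 K idx k i K.faces.ncard
      - persistentBetti 𝔽 K idx k (i - 1) K.faces.ncard := by
  have := persistentBetti_mono 𝔽 (idx := idx) hK k h
  rw [essentialMultiplicity, Int.toNat_of_nonneg]
  omega

/-- The number of points of the `k`-th persistence diagram that are born at `i`. -/
theorem births_eq (hK : K.faces.Finite) (k : ℕ) {i : ℕ} (h : i ≤ K.faces.ncard) :
    ((∑ j ∈ Finset.Ioc i K.faces.ncard, pairMultiplicity 𝔽 K idx k i j
      + essentialMultiplicity 𝔽 K idx k i : ℕ) : ℤ) =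
      persistentBetti 𝔽 K idx k i i - persistentBetti 𝔽 K idx k (i - 1) i := by
  push_cast
  rw [essentialMultiplicity_eq 𝔽 hK k h, Finset.sum_congr rfl fun j hj =>
    pairMultiplicity_eq 𝔽 hK k (Finset.mem_Ioc.1 hj).1]
  -- The sum over death times telescopes; its end term at the last stage cancels against the
  -- essential classes.
  have := sum_Ioc_sub (fun j => (persistentBetti 𝔽 K idx k (i - 1) j : ℤ) -
    persistentBetti 𝔽 K idx k i j) h
  rw [Finset.sum_congr rfl (fun j _ => (by ring :
    ((persistentBetti 𝔽 K idx k (i - 1) j : ℤ) - persistentBetti 𝔽 K idx k i j) -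
      ((persistentBetti 𝔽 K idx k (i - 1) (j - 1) : ℤ) - persistentBetti 𝔽 K idx k i (j - 1)) =
    (persistentBetti 𝔽 K idx k i (j - 1) - persistentBetti 𝔽 K idx k i j)
      - (persistentBetti 𝔽 K idx k (i - 1) (j - 1) - persistentBetti 𝔽 K idx k (i - 1) j)))] at this
  rw [this]
  ring

theorem stage_zero (hidx : IsIndexFiltration K f idx) : stage K idx 0 = ∅ := by
  ext σ
  simp only [stage, Set.mem_ofPred_eq, Set.mem_empty_iff_false, iff_false, not_and]
  intro hσ h
  have := (hidx.bijOn.mapsTo hσ).1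
  omega

theorem stage_top (hidx : IsIndexFiltration K f idx) : stage K idx K.faces.ncard = K.faces := by
  ext σ
  exact ⟨fun h => h.1, fun h => ⟨h, (hidx.bijOn.mapsTo h).2⟩⟩

theorem stageCycles_zero (hidx : IsIndexFiltration K f idx) (k : ℕ) : stageCycles 𝔽 K idx k 0 = ⊥ := by
  rw [stageCycles, stage_zero hidx, cycles, chains]
  simp

/-- The number of points of the `k`-th persistence diagram that die at `j`. -/
theorem deaths_eq (hK : K.faces.Finite) (hidx : IsIndexFiltration K f idx) (k : ℕ) {j : ℕ}
    (hj : 1 ≤ j) :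
    ((∑ i ∈ Finset.Ioc 0 (j - 1), pairMultiplicity 𝔽 K idx k i j : ℕ) : ℤ) =
      persistentBetti 𝔽 K idx k (j - 1) (j - 1) - persistentBetti 𝔽 K idx k (j - 1) j := by
  push_cast
  rw [Finset.sum_congr rfl fun i hi => pairMultiplicity_eq 𝔽 hK k
    (by have := (Finset.mem_Ioc.1 hi).2; omega : i < j),
    -- Here the sum over birth times telescopes; its lower end vanishes because stage 0 is empty.
    sum_Ioc_sub (fun i => (persistentBetti 𝔽 K idx k i (j - 1) : ℤ) -
      persistentBetti 𝔽 K idx k i j) (Nat.zero_le _),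
    persistentBetti_eq 𝔽 hK k (Nat.zero_le (j - 1)), persistentBetti_eq 𝔽 hK k (Nat.zero_le j),
    stageCycles_zero 𝔽 hidx, bot_inf_eq, bot_inf_eq]
  ring

theorem stage_erase_mem (hidx : IsIndexFiltration K f idx) (i : ℕ) :
    ∀ σ ∈ stage K idx i, 2 ≤ σ.card → ∀ [DecidableEq (Pt d)], ∀ v ∈ σ,
      σ.erase v ∈ stage K idx i := by
  intro σ hσ h2 _ v hv
  have hmem : σ.erase v ∈ K.faces := K.down_closed hσ.1 (Finset.erase_subset v σ)
    (Finset.card_pos.1 (by rw [Finset.card_erase_of_mem hv]; omega))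
  exact ⟨hmem, (hidx.face_lt _ hmem _ hσ.1 (Finset.erase_ssubset hv)).le.trans hσ.2⟩

theorem stageBoundaries_le_chains (hidx : IsIndexFiltration K f idx) (k i : ℕ) :
    stageBoundaries 𝔽 K idx k i ≤ chains 𝔽 (stage K idx i) k :=
  boundaries_le_chains 𝔽 _
    (fun σ hσ h2 v hv => @stage_erase_mem d K f idx hidx i σ hσ h2 (Classical.decEq _) v hv) k

open scoped Classical in
theorem stage_eq_insert (hidx : IsIndexFiltration K f idx) {τ : Finset (Pt d)} (hτ : τ ∈ K.faces) :
    stage K idx (idx τ) = insert τ (stage K idx (idx τ - 1)) := by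
  have h1 := (hidx.bijOn.mapsTo hτ).1
  ext σ
  constructor
  · intro h
    rcases eq_or_ne σ τ with rfl | hne
    · exact Or.inl rfl
    · have : idx σ ≠ idx τ := fun h' => hne (hidx.bijOn.injOn h.1 hτ h')
      have := h.2
      exact Or.inr ⟨h.1, by omega⟩
  · rintro (rfl | h)
    · exact ⟨hτ, le_rfl⟩
    · exact stage_mono K idx (Nat.sub_le _ 1) h

theorem chains_stage_eq (hidx : IsIndexFiltration K f idx) {τ : Finset (Pt d)} (hτ : τ ∈ K.faces)
    {k : ℕ} (hk : τ.card ≠ k + 1) :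
    chains 𝔽 (stage K idx (idx τ)) k = chains 𝔽 (stage K idx (idx τ - 1)) k := by
  rw [chains, chains, stage_eq_insert hidx hτ]
  congr 1
  ext σ
  constructor
  · rintro ⟨rfl | h, h2⟩
    · exact absurd h2 hk
    · exact ⟨h, h2⟩
  · exact fun h => ⟨Or.inr h.1, h.2⟩

theorem finrank_chains_stage (hK : K.faces.Finite) (hidx : IsIndexFiltration K f idx)
    {τ : Finset (Pt d)} (hτ : τ ∈ K.faces) (k : ℕ) :
    Module.finrank 𝔽 (chains 𝔽 (stage K idx (idx τ)) k) =
      Module.finrank 𝔽 (chains 𝔽 (stage K idx (idx τ - 1)) k) +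
        if τ.card = k + 1 then 1 else 0 := by
  split_ifs with h
  · have h1 := (hidx.bijOn.mapsTo hτ).1
    rw [finrank_chains 𝔽 (stage_finite hK _), finrank_chains 𝔽 (stage_finite hK _),
      ← Set.ncard_insert_of_notMem (a := τ) ?_ ((stage_finite hK _).subset fun σ hσ => hσ.1)]
    · rw [stage_eq_insert hidx hτ]
      congr 1
      ext σ
      constructor
      · rintro ⟨rfl | h, h2⟩
        · exact Or.inl rfl
        · exact Or.inr ⟨h, h2⟩
      · rintro (rfl | h')
        · exact ⟨Or.inl rfl, h⟩
        · exact ⟨Or.inr h'.1, h'.2⟩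
    · rintro ⟨⟨_, h2⟩, _⟩
      omega
  · rw [chains_stage_eq 𝔽 hidx hτ h, add_zero]

open Module in
/-- At an edge either a class of dimension `0` dies or a class of dimension `1` is born; at other
simplices, neither happens. -/
theorem deaths_add_births (hK : K.faces.Finite) (hidx : IsIndexFiltration K f idx)
    {τ : Finset (Pt d)} (hτ : τ ∈ K.faces) :
    ∑ i ∈ Finset.Ioc 0 (idx τ - 1), pairMultiplicity 𝔽 K idx 0 i (idx τ)
      + (∑ j ∈ Finset.Ioc (idx τ) K.faces.ncard, pairMultiplicity 𝔽 K idx 1 (idx τ) j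
        + essentialMultiplicity 𝔽 K idx 1 (idx τ)) = if τ.card = 2 then 1 else 0 := by
  obtain ⟨h1, h2⟩ := hidx.bijOn.mapsTo hτ
  have hd := deaths_eq 𝔽 hK hidx 0 h1
  have hb := births_eq 𝔽 (idx := idx) hK 1 h2
  have hc := finrank_chains_stage 𝔽 hK hidx hτ 1
  -- Rank-nullity for the boundary operator on 1-chains. The identities `e1`, `e2`, `e3` below
  -- reduce deaths to the growth of `B₀` and births to the growth of `Z₁`; the relation `∂∂ = 0` is
  -- not needed.
  have rn (i : ℕ) : finrank 𝔽 (stageBoundaries 𝔽 K idx 0 i) + finrank 𝔽 (stageCycles 𝔽 K idx 1 i) =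
      finrank 𝔽 (chains 𝔽 (stage K idx i) 1) := by
    have := finiteDimensional_chains 𝔽 (stage_finite (idx := idx) hK i) 1
    exact finrank_map_add_finrank_inf_ker _ _
  have hrn := rn (idx τ)
  have hrn' := rn (idx τ - 1)
  rw [persistentBetti_eq 𝔽 hK 0 le_rfl, persistentBetti_eq 𝔽 hK 0 (Nat.sub_le _ 1)] at hd
  rw [persistentBetti_eq 𝔽 hK 1 le_rfl, persistentBetti_eq 𝔽 hK 1 (Nat.sub_le _ 1)] at hb
  have hZ0 (i : ℕ) : stageCycles 𝔽 K idx 0 i = chains 𝔽 (stage K idx i) 0 := cycles_zero 𝔽 _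
  have e1 : stageCycles 𝔽 K idx 0 (idx τ - 1) ⊓ stageBoundaries 𝔽 K idx 0 (idx τ - 1) =
      stageBoundaries 𝔽 K idx 0 (idx τ - 1) := by
    rw [hZ0]
    exact inf_eq_right.2 (stageBoundaries_le_chains 𝔽 hidx 0 _)
  -- If τ is an edge it brings no new vertex, so even the new boundaries are 0-chains of the
  -- previous stage; otherwise `B₀` does not change.
  have e2 : stageCycles 𝔽 K idx 0 (idx τ - 1) ⊓ stageBoundaries 𝔽 K idx 0 (idx τ) =
      stageBoundaries 𝔽 K idx 0 (idx τ) := by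
    by_cases h : τ.card = 2
    · rw [hZ0, ← chains_stage_eq 𝔽 hidx hτ (by omega)]
      exact inf_eq_right.2 (stageBoundaries_le_chains 𝔽 hidx 0 _)
    · have : stageBoundaries 𝔽 K idx 0 (idx τ) =
      stageBoundaries 𝔽 K idx 0 (idx τ - 1) := by
        rw [stageBoundaries, boundaries, chains_stage_eq 𝔽 hidx hτ h]
        rfl
      rw [this, e1]
  -- If τ is an edge, no triangle is added and the 1-boundaries avoid τ, so a cycle among them is
  -- already a cycle of the previous stage; otherwise `Z₁` does not change.
  have e3 : stageCycles 𝔽 K idx 1 (idx τ - 1) ⊓ stageBoundaries 𝔽 K idx 1 (idx τ) =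
      stageCycles 𝔽 K idx 1 (idx τ) ⊓ stageBoundaries 𝔽 K idx 1 (idx τ) := by
    by_cases h : τ.card = 2
    · have hB : stageBoundaries 𝔽 K idx 1 (idx τ) ≤ chains 𝔽 (stage K idx (idx τ - 1)) 1 := by
        refine le_trans (le_of_eq ?_) (stageBoundaries_le_chains 𝔽 hidx 1 _)
        rw [stageBoundaries, boundaries, chains_stage_eq 𝔽 hidx hτ (by omega)]
        rfl
      refine le_antisymm (inf_le_inf_right _ (stageCycles_mono 𝔽 1 (Nat.sub_le _ 1))) ?_
      exact fun x hx => ⟨⟨hB hx.2, hx.1.2⟩, hx.2⟩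
    · have : stageCycles 𝔽 K idx 1 (idx τ) = stageCycles 𝔽 K idx 1 (idx τ - 1) := by
        rw [stageCycles, cycles, chains_stage_eq 𝔽 hidx hτ h]
        rfl
      rw [this]
  rw [e1, e2] at hd
  rw [e3] at hb
  have : ((if τ.card = 1 + 1 then 1 else 0 : ℕ)) = if τ.card = 2 then 1 else 0 := rfl
  omega

/-! ### From the index filtration to the augmented diagram -/

theorem sum_faces_eq (hK : K.faces.Finite) (hidx : IsIndexFiltration K f idx) (g : ℕ → ℕ) :
    ∑ τ ∈ hK.toFinset, g (idx τ) = ∑ i ∈ Finset.Ioc 0 K.faces.ncard, g i := by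
  refine Finset.sum_nbij idx (fun τ hτ => ?_) (fun σ hσ τ hτ h => ?_) (fun i hi => ?_)
    fun _ _ => rfl
  · have := hidx.bijOn.mapsTo (hK.mem_toFinset.1 hτ)
    exact Finset.mem_Ioc.2 ⟨this.1, this.2⟩
  · exact hidx.bijOn.injOn (by simpa using hσ) (by simpa using hτ) h
  · obtain ⟨h1, h2⟩ := Finset.mem_Ioc.1 (Finset.mem_coe.1 hi)
    obtain ⟨τ, hτ, rfl⟩ := hidx.bijOn.surjOn ⟨h1, h2⟩
    exact ⟨τ, by simpa using hτ, rfl⟩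

theorem sum_faces_gt (hK : K.faces.Finite) (hidx : IsIndexFiltration K f idx) (i : ℕ)
    (g : ℕ → ℕ) : ∑ τ ∈ hK.toFinset with i < idx τ, g (idx τ) =
      ∑ j ∈ Finset.Ioc i K.faces.ncard, g j := by
  rw [Finset.sum_filter, sum_faces_eq hK hidx (fun j => if i < j then g j else 0),
    ← Finset.sum_filter]
  congr 1
  ext j
  simp only [Finset.mem_filter, Finset.mem_Ioc]
  omega

theorem sum_faces_lt (hK : K.faces.Finite) (hidx : IsIndexFiltration K f idx) {j : ℕ}
    (hj : j ≤ K.faces.ncard) (g : ℕ → ℕ) : ∑ τ ∈ hK.toFinset with idx τ < j, g (idx τ) =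
      ∑ i ∈ Finset.Ioc 0 (j - 1), g i := by
  rw [Finset.sum_filter, sum_faces_eq hK hidx (fun i => if i < j then g i else 0),
    ← Finset.sum_filter]
  congr 1
  ext i
  simp only [Finset.mem_filter, Finset.mem_Ioc]
  omega

theorem Multiset.countP_replicate_eq_ite {α : Type*} (p : α → Prop) [DecidablePred p] (n : ℕ) (a : α) :
    (Multiset.replicate n a).countP p = if p a then n else 0 := by
  split_ifs with h
  · rw [Multiset.countP_eq_card.2, Multiset.card_replicate]
    intro b hb
    rwa [Multiset.eq_of_mem_replicate hb]
  · refine Multiset.countP_eq_zero.2 fun b hb => ?_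
    rwa [Multiset.eq_of_mem_replicate hb]

theorem Multiset.countP_finset_sum {ι α : Type*} (p : α → Prop) [DecidablePred p] (s : Finset ι)
    (g : ι → Multiset α) : (∑ i ∈ s, g i).countP p = ∑ i ∈ s, (g i).countP p :=
  map_sum (Multiset.countPAddMonoidHom p) g s

-- Essential points have death `⊤`, which is no real height, so only finite pairs contribute; they
-- are grouped by the simplex at which they die.
open scoped Classical in
theorem countP_death (hK : K.faces.Finite) (hidx : IsIndexFiltration K f idx) (k : ℕ) (c : ℝ) :
    (augmentedDiagram 𝔽 K hK f idx k).countP (fun p => p.2 = (c : EReal)) =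
      ∑ τ ∈ hK.toFinset with f τ = c,
        ∑ i ∈ Finset.Ioc 0 (idx τ - 1), pairMultiplicity 𝔽 K idx k i (idx τ) := by
  rw [augmentedDiagram, Multiset.countP_add, Multiset.countP_finset_sum, Multiset.countP_finset_sum]
  simp only [Multiset.countP_finset_sum, Multiset.countP_replicate_eq_ite, EReal.top_ne_coe, if_false,
    Finset.sum_const_zero,
    add_zero, EReal.coe_eq_coe_iff]
  simp only [Finset.sum_filter]
  rw [Finset.sum_comm]
  refine Finset.sum_congr rfl fun τ hτ => ?_
  split_ifs with h
  · rw [← sum_faces_lt hK hidx (hidx.bijOn.mapsTo (hK.mem_toFinset.1 hτ)).2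
      (fun i => pairMultiplicity 𝔽 K idx k i (idx τ)), Finset.sum_filter]
  · simp

open scoped Classical in
theorem countP_birth (hK : K.faces.Finite) (hidx : IsIndexFiltration K f idx) (k : ℕ) (c : ℝ) :
    (augmentedDiagram 𝔽 K hK f idx k).countP (fun p => p.1 = c) =
      ∑ τ ∈ hK.toFinset with f τ = c,
        (∑ j ∈ Finset.Ioc (idx τ) K.faces.ncard, pairMultiplicity 𝔽 K idx k (idx τ) j
          + essentialMultiplicity 𝔽 K idx k (idx τ)) := by
  rw [augmentedDiagram, Multiset.countP_add, Multiset.countP_finset_sum, Multiset.countP_finset_sum,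
    ← Finset.sum_add_distrib]
  simp only [Multiset.countP_finset_sum, Multiset.countP_replicate_eq_ite]
  rw [Finset.sum_filter]
  refine Finset.sum_congr rfl fun τ hτ => ?_
  split_ifs with h
  · rw [sum_faces_gt hK hidx (idx τ) (fun j => pairMultiplicity 𝔽 K idx k (idx τ) j)]
  · simp

-- The births at stage `i` are at most the growth of the cycle space there, and the sum telescopes
-- to at most the dimension of all `k`-chains. This bounds the time needed to read a diagram.
open Module in
theorem card_augmentedDiagram_le (hK : K.faces.Finite) (hidx : IsIndexFiltration K f idx) (k : ℕ) :
    (augmentedDiagram 𝔽 K hK f idx k).card ≤ {σ | σ ∈ K.faces ∧ σ.card = k + 1}.ncard := by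
  rw [augmentedDiagram, Multiset.card_add, Multiset.card_sum, Multiset.card_sum,
    ← Finset.sum_add_distrib]
  simp only [Multiset.card_sum, Multiset.card_replicate]
  rw [Finset.sum_congr rfl fun τ _ => congrArg (· + essentialMultiplicity 𝔽 K idx k (idx τ))
    (sum_faces_gt hK hidx (idx τ) fun j => pairMultiplicity 𝔽 K idx k (idx τ) j),
    sum_faces_eq hK hidx (fun i => ∑ j ∈ Finset.Ioc i K.faces.ncard,
    pairMultiplicity 𝔽 K idx k i j + essentialMultiplicity 𝔽 K idx k i)]
  have hfin (i : ℕ) := finiteDimensional_cycles 𝔽 (fun v => idx {v})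
    (stage_finite (idx := idx) hK i) k
  have hle : ∀ i ∈ Finset.Ioc 0 K.faces.ncard,
      ((∑ j ∈ Finset.Ioc i K.faces.ncard, pairMultiplicity 𝔽 K idx k i j
        + essentialMultiplicity 𝔽 K idx k i : ℕ) : ℤ) ≤
        (finrank 𝔽 (stageCycles 𝔽 K idx k i) : ℤ) - finrank 𝔽 (stageCycles 𝔽 K idx k (i - 1)) := by
    intro i hi
    rw [births_eq 𝔽 hK k (Finset.mem_Ioc.1 hi).2, persistentBetti_eq 𝔽 hK k le_rfl,
      persistentBetti_eq 𝔽 hK k (Nat.sub_le i 1)]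
    have : FiniteDimensional 𝔽 (stageCycles 𝔽 K idx k i ⊓ stageBoundaries 𝔽 K idx k i : Submodule 𝔽 _) :=
      Submodule.finiteDimensional_of_le inf_le_left
    have := Submodule.finrank_mono (inf_le_inf_right (stageBoundaries 𝔽 K idx k i)
      (stageCycles_mono 𝔽 (K := K) (idx := idx) k (Nat.sub_le i 1)))
    omega
  have h := Finset.sum_le_sum hle
  rw [sum_Ioc_sub (fun i => (finrank 𝔽 (stageCycles 𝔽 K idx k i) : ℤ)) (Nat.zero_le _)] at h
  have h2 : finrank 𝔽 (stageCycles 𝔽 K idx k K.faces.ncard) ≤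
      finrank 𝔽 (chains 𝔽 (stage K idx K.faces.ncard) k) := by
    have := finiteDimensional_chains 𝔽 (stage_finite (idx := idx) hK K.faces.ncard) k
    exact Submodule.finrank_mono inf_le_left
  rw [finrank_chains 𝔽 (stage_finite hK _), stage_top hidx] at h2
  zify at h2 ⊢
  push_cast at h
  linarith [(Nat.cast_nonneg _ : (0 : ℤ) ≤ finrank 𝔽 (stageCycles 𝔽 K idx k 0))]

variable {hK : K.faces.Finite} {O : Dir d → Diagram}

theorem length_diagram_le (hO : IsOracle 𝔽 K hK O) (s : Dir d) (k : ℕ) :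
    (O s k).length ≤ {σ | σ ∈ K.faces ∧ σ.card = k + 1}.ncard := by
  obtain ⟨idx, hidx, h⟩ := hO s
  rw [← Multiset.coe_card, h k]
  exact card_augmentedDiagram_le 𝔽 hK hidx k

-- This is `deaths_add_births` summed over the simplices of height `c`: each edge contributes one
-- and every other simplex zero.
open scoped Classical in
theorem run_indegree (hO : IsOracle 𝔽 K hK O) (s : Dir d) (c : ℝ) :
    (indegree (d := d) (O s) c).run O =
      (hK.toFinset.filter fun τ => τ.card = 2 ∧ lowerStar s τ = c).card := by
  obtain ⟨idx, hidx, h⟩ := hO s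
  simp only [indegree, Prog.run_bind, Prog.run_count, Prog.run_op]
  have hd := countP_death 𝔽 hK hidx 0 c
  have hb := countP_birth 𝔽 hK hidx 1 c
  have key := Finset.sum_congr (rfl : hK.toFinset.filter (fun τ => lowerStar s τ = c) = _)
    fun τ hτ => deaths_add_births 𝔽 hK hidx (hK.mem_toFinset.1 (Finset.mem_filter.1 hτ).1)
  rw [Finset.sum_add_distrib, ← hd, ← hb, ← h 0, ← h 1, Multiset.coe_countP, Multiset.coe_countP,
    ← Finset.card_filter, Finset.filter_filter] at key
  simp only [and_comm (b := lowerStar s _ = c)]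
  convert key

@[simp] theorem diagrams_indegree (O : Dir d → Diagram) (D : Diagram) (c : ℝ) :
    (indegree (d := d) D c).diagrams O = 0 := by
  simp [indegree]

theorem time_indegree (O : Dir d → Diagram) (T : ℕ) (D : Diagram) (c : ℝ) :
    (indegree (d := d) D c).time O T = (D 0).length + (D 1).length + 3 := by
  simp [indegree]
  omega

end Persistence

/-! ### Edges as pairs, and the indegree of a vertex -/

section Adjacency

variable {d : ℕ} {K : Geometry.SimplicialComplex ℝ (Pt d)}

/-- `v` and `u` are joined by an edge of `K`. -/
def EdgeAdj (K : Geometry.SimplicialComplex ℝ (Pt d)) (v u : Pt d) : Prop :=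
  edgeOf (v, u) ∈ edgeSet K

theorem edgeOf_comm (v u : Pt d) : edgeOf (v, u) = edgeOf (u, v) :=
  Finset.pair_comm v u

theorem mem_edgeOf {x : Pt d} {e : Pt d × Pt d} : x ∈ edgeOf e ↔ x = e.1 ∨ x = e.2 := by
  simp [edgeOf]

theorem EdgeAdj.symm {v u : Pt d} (h : EdgeAdj K v u) : EdgeAdj K u v := by
  rwa [EdgeAdj, edgeOf_comm]

theorem EdgeAdj.ne {v u : Pt d} (h : EdgeAdj K v u) : v ≠ u := by
  rintro rfl
  have := h.2
  simp [edgeOf] at this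

theorem EdgeAdj.right_mem {v u : Pt d} (h : EdgeAdj K v u) : u ∈ K.vertices :=
  K.down_closed h.1 (Finset.singleton_subset_iff.2 (mem_edgeOf.2 (Or.inr rfl)))
    (Finset.singleton_nonempty u)

theorem EdgeAdj.left_mem {v u : Pt d} (h : EdgeAdj K v u) : v ∈ K.vertices :=
  h.symm.right_mem

theorem exists_edgeOf_eq {σ : Finset (Pt d)} (h : σ.card = 2) :
    ∃ a b, a ≠ b ∧ σ = edgeOf (a, b) := by
  classical
  obtain ⟨a, b, hab, rfl⟩ := Finset.card_eq_two.1 h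
  refine ⟨a, b, hab, ?_⟩
  ext x
  simp [mem_edgeOf]

theorem lowerStar_edgeOf (s : Dir d) (v u : Pt d) :
    lowerStar s (edgeOf (v, u)) = max (inner ℝ (s : Pt d) v) (inner ℝ (s : Pt d) u) := by
  have hne : (edgeOf (v, u)).Nonempty := ⟨v, mem_edgeOf.2 (Or.inl rfl)⟩
  rw [lowerStar, dif_pos hne]
  refine le_antisymm (Finset.sup'_le _ _ fun x hx => ?_) (max_le ?_ ?_)
  · rcases mem_edgeOf.1 hx with rfl | rfl
    · exact le_max_left _ _
    · exact le_max_right _ _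
  · exact Finset.le_sup' (fun x => inner ℝ (s : Pt d) x) (mem_edgeOf (e := (v, u)).2 (Or.inl rfl))
  · exact Finset.le_sup' (fun x => inner ℝ (s : Pt d) x) (mem_edgeOf (e := (v, u)).2 (Or.inr rfl))

theorem edgeOf_right_injective (v : Pt d) : Function.Injective fun u => edgeOf (v, u) := by
  intro u w h
  replace h : edgeOf (v, u) = edgeOf (v, w) := h
  have h1 : u ∈ edgeOf (v, w) := h ▸ mem_edgeOf.2 (Or.inr rfl)
  have h2 : w ∈ edgeOf (v, u) := h ▸ mem_edgeOf.2 (Or.inr rfl)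
  rcases mem_edgeOf.1 h1 with h1 | h1
  · rcases mem_edgeOf.1 h2 with h2 | h2
    · exact h1.trans h2.symm
    · exact h2.symm
  · exact h1

variable {𝔽 : Type*} [Field 𝔽] {hK : K.faces.Finite} {O : Dir d → Diagram}

/-- In a direction in which `v` is the only vertex of its height, the indegree read off the diagram
is the number of neighbours below `v`. -/
theorem run_indegree_eq_length (hO : IsOracle 𝔽 K hK O) {s : Dir d} {v : Pt d}
    (hs : ∀ u ∈ K.vertices, u ≠ v → inner ℝ (s : Pt d) u ≠ inner ℝ (s : Pt d) v) {l : List (Pt d)}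
    (hl : l.Nodup)
    (hmem : ∀ u, u ∈ l ↔ EdgeAdj K v u ∧ inner ℝ (s : Pt d) u < inner ℝ (s : Pt d) v) :
    (indegree (d := d) (O s) (inner ℝ (s : Pt d) v)).run O = l.length := by
  classical
  rw [run_indegree 𝔽 hO, ← List.toFinset_card_of_nodup hl]
  symm
  refine Finset.card_nbij (fun u => edgeOf (v, u)) (fun u hu => ?_)
    (edgeOf_right_injective v).injOn (fun τ hτ => ?_)
  · obtain ⟨h1, h2⟩ := (hmem u).1 (List.mem_toFinset.1 hu)
    refine Finset.mem_filter.2 ⟨hK.mem_toFinset.2 h1.1, h1.2, ?_⟩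
    rw [lowerStar_edgeOf, max_eq_left h2.le]
  · obtain ⟨h1, h2, h3⟩ := Finset.mem_filter.1 (Finset.mem_coe.1 hτ)
    obtain ⟨a, b, hab, rfl⟩ := exists_edgeOf_eq h2
    have hadj : EdgeAdj K a b := ⟨hK.mem_toFinset.1 h1, h2⟩
    -- The higher endpoint of an edge of height `s · v` must be `v`, the only vertex at that height.
    -- The claim is stated for either order of the endpoints.
    have key : ∀ a b, EdgeAdj K a b →
        max (inner ℝ (s : Pt d) a) (inner ℝ (s : Pt d) b) = inner ℝ (s : Pt d) v →
        inner ℝ (s : Pt d) b ≤ inner ℝ (s : Pt d) a →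
        edgeOf (a, b) ∈ (fun u => edgeOf (v, u)) '' (l.toFinset : Set (Pt d)) := by
      intro a b hadj hmax hle
      rw [max_eq_left hle] at hmax
      have hav : a = v := by
        by_contra hne
        exact hs a hadj.left_mem hne hmax
      subst hav
      exact ⟨b, Finset.mem_coe.2 (List.mem_toFinset.2 ((hmem b).2
        ⟨hadj, lt_of_le_of_ne hle (hs b hadj.right_mem hadj.ne.symm)⟩)), rfl⟩
    rw [lowerStar_edgeOf] at h3
    rcases le_total (inner ℝ (s : Pt d) b) (inner ℝ (s : Pt d) a) with h | h
    · exact key a b hadj h3 h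
    · rw [edgeOf_comm]
      exact key b a hadj.symm (by rw [max_comm, h3]) h

end Adjacency

/-! ### Heights and angles in the projection plane -/

namespace Frame

variable {d : ℕ} (b : Frame d)

theorem inner_dir (φ : ℝ) (v : Pt d) : inner ℝ (b.dir φ : Pt d) v = b.height φ v := by
  simp [dir, height, x₁, x₂, inner_add_left, inner_smul_left]

theorem inner_negDir (v : Pt d) : inner ℝ (b.negDir : Pt d) v = -b.x₁ v := by
  simp [negDir, x₁]

theorem angle_pos (v u : Pt d) : 0 < b.angle v u := by
  have := Real.arctan_lt_pi_div_two ((b.x₂ u - b.x₂ v) / (b.x₁ u - b.x₁ v))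
  rw [angle]
  linarith

theorem angle_lt_pi (v u : Pt d) : b.angle v u < Real.pi := by
  have := Real.neg_pi_div_two_lt_arctan ((b.x₂ u - b.x₂ v) / (b.x₁ u - b.x₁ v))
  rw [angle]
  linarith

/-- Polar coordinates around `v`, with `r = √(1 + t²)` for the slope `t`. The signed factor `b.x₁ u
- b.x₁ v` makes one formula serve for points above and below `v`, although `angle` only knows the
line. -/
theorem height_sub_height {v u : Pt d} (h : b.x₁ u ≠ b.x₁ v) : ∃ r : ℝ, 0 < r ∧ ∀ φ : ℝ,
    b.height φ u - b.height φ v = (b.x₁ u - b.x₁ v) * (r * Real.cos (b.angle v u - φ)) := by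
  have hne : b.x₁ u - b.x₁ v ≠ 0 := sub_ne_zero.2 h
  set t := (b.x₂ u - b.x₂ v) / (b.x₁ u - b.x₁ v) with ht
  have ht' : b.x₂ u - b.x₂ v = t * (b.x₁ u - b.x₁ v) := by rw [ht]; field_simp
  have hpos : 0 < √(1 + t ^ 2) := Real.sqrt_pos.2 (by positivity)
  refine ⟨√(1 + t ^ 2), hpos, fun φ => ?_⟩
  have hang : b.angle v u = Real.pi / 2 - Real.arctan t := rfl
  rw [hang, Real.cos_sub, Real.cos_pi_div_two_sub, Real.sin_pi_div_two_sub, Real.sin_arctan,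
    Real.cos_arctan, height, height]
  have : b.x₂ u = b.x₂ v + t * (b.x₁ u - b.x₁ v) := by linarith
  rw [this]
  field_simp
  ring

theorem collinear_of_angle_eq {v u w : Pt d} (hu : b.x₁ u ≠ b.x₁ v) (hw : b.x₁ w ≠ b.x₁ v)
    (h : b.angle v u = b.angle v w) : Collinear ℝ {b.proj v, b.proj u, b.proj w} := by
  have h1 : (b.x₂ u - b.x₂ v) / (b.x₁ u - b.x₁ v) = (b.x₂ w - b.x₂ v) / (b.x₁ w - b.x₁ v) := by
    apply Real.arctan_injective
    simp only [angle] at h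
    linarith
  have hu' := sub_ne_zero.2 hu
  have hw' := sub_ne_zero.2 hw
  rw [collinear_iff_of_mem (p₀ := b.proj v) (by simp)]
  refine ⟨!₂[1, (b.x₂ u - b.x₂ v) / (b.x₁ u - b.x₁ v)], fun p hp => ?_⟩
  rcases hp with rfl | rfl | rfl
  · exact ⟨0, by simp⟩
  · refine ⟨b.x₁ u - b.x₁ v, ?_⟩
    ext i
    fin_cases i <;> simp [proj]
    field_simp
    ring
  · refine ⟨b.x₁ w - b.x₁ v, ?_⟩
    rw [h1]
    ext i
    fin_cases i <;> simp [proj]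
    field_simp
    ring

/-- The lines from `v` to the points of `S` enclose angles of at least `θ`. -/
structure IsSeparating (v : Pt d) (S : Set (Pt d)) (θ : ℝ) : Prop where
  pos : 0 < θ
  gap : ∀ u ∈ S, ∀ w ∈ S, b.angle v w < b.angle v u → b.angle v w + θ ≤ b.angle v u
  wrap : ∀ u ∈ S, ∀ w ∈ S, b.angle v u - Real.pi + θ ≤ b.angle v w

variable {b} {v : Pt d} {S : Set (Pt d)} {θ : ℝ}

/-- By the wrap-around bound, the argument lies between `θ/2` and `π - θ/2`. -/
theorem IsSeparating.sin_pos (h : b.IsSeparating v S θ) {u w : Pt d} (hu : u ∈ S) (hw : w ∈ S)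
    (huw : b.angle v w ≤ b.angle v u) :
    0 < Real.sin (b.angle v u - b.angle v w + θ / 2) := by
  have := h.wrap u hu w hw
  have := h.pos
  exact Real.sin_pos_of_pos_of_lt_pi (by linarith) (by linarith)

/-- By the gap, the argument is at most `-θ/2`; by the wrap-around bound, it stays above `-π`. -/
theorem IsSeparating.sin_neg (h : b.IsSeparating v S θ) {u w : Pt d} (hu : u ∈ S) (hw : w ∈ S)
    (huw : b.angle v u < b.angle v w) :
    Real.sin (b.angle v u - b.angle v w + θ / 2) < 0 := by
  have := h.gap w hw u hu huw
  have := h.wrap w hw u hu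
  have := h.pos
  exact Real.sin_neg_of_neg_of_neg_pi_lt (by linarith) (by linarith)

theorem height_tilted {u : Pt d} (h : b.x₁ u ≠ b.x₁ v) (α θ : ℝ) : ∃ r : ℝ, 0 < r ∧
    b.height (α - Real.pi / 2 - θ / 2) u - b.height (α - Real.pi / 2 - θ / 2) v =
      -((b.x₁ u - b.x₁ v) * (r * Real.sin (b.angle v u - α + θ / 2))) := by
  obtain ⟨r, hr, h⟩ := b.height_sub_height h
  refine ⟨r, hr, ?_⟩
  rw [h, ← mul_neg, ← mul_neg, ← Real.cos_add_pi_div_two]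
  ring_nf

/-- The vertices below `v` matter here as well: the tilted level line through `v` must miss them for
the indegree at `v` to be readable. This is why `θ` separates all lines and not only the rays
upwards. -/
theorem IsSeparating.height_ne (h : b.IsSeparating v S θ) {u w : Pt d} (hu : u ∈ S) (hw : w ∈ S)
    (hne : b.x₁ u ≠ b.x₁ v) : b.height (b.angle v w - Real.pi / 2 - θ / 2) u ≠
      b.height (b.angle v w - Real.pi / 2 - θ / 2) v := by
  obtain ⟨r, hr, heq⟩ := height_tilted hne (b.angle v w) θ
  rw [← sub_ne_zero, heq]
  refine neg_ne_zero.2 (mul_ne_zero (sub_ne_zero.2 hne) (mul_ne_zero hr.ne' ?_))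
  rcases le_or_gt (b.angle v w) (b.angle v u) with h' | h'
  · exact (h.sin_pos hu hw h').ne'
  · exact (h.sin_neg hu hw h').ne

theorem IsSeparating.height_lt_iff (h : b.IsSeparating v S θ) {u w : Pt d} (hu : u ∈ S)
    (hw : w ∈ S) (hlt : b.x₁ v < b.x₁ u) : b.height (b.angle v w - Real.pi / 2 - θ / 2) u <
      b.height (b.angle v w - Real.pi / 2 - θ / 2) v ↔ b.angle v w ≤ b.angle v u := by
  obtain ⟨r, hr, heq⟩ := height_tilted hlt.ne' (b.angle v w) θ
  rw [← sub_neg, heq, neg_lt_zero, mul_pos_iff_of_pos_left (sub_pos.2 hlt),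
    mul_pos_iff_of_pos_left hr]
  refine ⟨fun hs => ?_, h.sin_pos hu hw⟩
  by_contra hc
  exact absurd hs (not_lt.2 (h.sin_neg hu hw (not_le.1 hc)).le)

end Frame

/-! ### Binary search around a vertex -/

section Search

variable {d : ℕ} {𝔽 : Type*} [Field 𝔽] {K : Geometry.SimplicialComplex ℝ (Pt d)}
  {hK : K.faces.Finite} {O : Dir d → Diagram} {b : Frame d} {v : Pt d} {θ : ℝ}
  {above : List (Pt d)}

/-- `above` lists the vertices above `v` clockwise, and `θ` separates the lines from `v` to the
other vertices. -/
structure IsRadialSort (K : Geometry.SimplicialComplex ℝ (Pt d)) (b : Frame d) (v : Pt d) (θ : ℝ)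
    (above : List (Pt d)) : Prop where
  mem_vertices : v ∈ K.vertices
  inj : ∀ u ∈ K.vertices, u ≠ v → b.x₁ u ≠ b.x₁ v
  separating : b.IsSeparating v {u | u ∈ K.vertices ∧ u ≠ v} θ
  sorted : above.Pairwise fun u w => b.angle v w < b.angle v u
  mem_iff : ∀ u, u ∈ above ↔ u ∈ K.vertices ∧ b.x₁ v < b.x₁ u

/-- `known` lists the neighbours of `v` that are below `v` or in `pre`. -/
structure IsKnown (K : Geometry.SimplicialComplex ℝ (Pt d)) (b : Frame d) (v : Pt d)
    (pre known : List (Pt d)) : Prop where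
  nodup : known.Nodup
  mem_iff : ∀ u, u ∈ known ↔ EdgeAdj K v u ∧ (b.x₁ u < b.x₁ v ∨ u ∈ pre)

theorem IsRadialSort.nodup (h : IsRadialSort K b v θ above) : above.Nodup :=
  h.sorted.imp fun h heq => by rw [heq] at h; exact lt_irrefl _ h

theorem IsRadialSort.ne_of_mem (h : IsRadialSort K b v θ above) {u : Pt d} (hu : u ∈ above) :
    u ≠ v := by
  rintro rfl
  exact lt_irrefl _ ((h.mem_iff u).1 hu).2

-- Among the vertices above `v`, the tilted half-plane contains exactly `pre` and `left`. A
-- neighbour in it is therefore either already known (below `v` or in `pre`) or in `left`.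
open scoped Classical in
theorem run_leftCount (hO : IsOracle 𝔽 K hK O) {pre left post known : List (Pt d)}
    (hR : IsRadialSort K b v θ (pre ++ (left ++ post))) (hleft : left ≠ [])
    (hknown : IsKnown K b v pre known) :
    (leftCount b v θ left known).run O = left.countP fun u => decide (EdgeAdj K v u) := by
  have hsorted := hR.sorted
  have hnodup := hR.nodup
  set w := left.getLast hleft with hw
  have hwleft : w ∈ left := List.getLast_mem hleft
  have hlast : left.getLastD v = w := by
    rw [List.getLastD_eq_getLast?, List.getLast?_eq_some_getLast hleft]
    rfl
  have hwmem : w ∈ pre ++ (left ++ post) := by simp [hwleft]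
  have hwS : w ∈ {u | u ∈ K.vertices ∧ u ≠ v} :=
    ⟨((hR.mem_iff w).1 hwmem).1, hR.ne_of_mem hwmem⟩
  have hle : ∀ u ∈ left, b.angle v w ≤ b.angle v u := by
    intro u hu
    rw [← List.dropLast_append_getLast hleft] at hu
    rcases List.mem_append.1 hu with hu | hu
    · have h1 : left.Pairwise fun u w => b.angle v w < b.angle v u :=
        (List.pairwise_append.1 (List.pairwise_append.1 hsorted).2.1).1
      rw [← List.dropLast_append_getLast hleft] at h1
      exact ((List.pairwise_append.1 h1).2.2 u hu w (by simp [hw])).le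
    · rw [List.mem_singleton.1 hu]
  have hpost : ∀ u ∈ post, b.angle v u < b.angle v w := fun u hu =>
    (List.pairwise_append.1 (List.pairwise_append.1 hsorted).2.1).2.2 w hwleft u hu
  simp only [leftCount, Prog.run_bind, Prog.run_op, Prog.run_query, Prog.run_count, hlast]
  set φ := b.angle v w - Real.pi / 2 - θ / 2 with hφ
  have hx (u : Pt d) (h : EdgeAdj K v u) : u ∈ {u | u ∈ K.vertices ∧ u ≠ v} :=
    ⟨h.right_mem, h.ne.symm⟩
  -- The lower neighbours of `v` in the tilted direction, listed as the known ones on that side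
  -- followed by the neighbours in `left`. The two parts are disjoint, so the natural-number
  -- subtraction is exact.
  have key := run_indegree_eq_length 
    (l := known.filter (fun u => decide (b.height φ u < b.height φ v)) ++ left.filter
      fun u => decide (EdgeAdj K v u)) hO (s := b.dir φ) (v := v) ?_ ?_ ?_
  · rw [b.inner_dir, List.length_append, ← List.countP_eq_length_filter,
      ← List.countP_eq_length_filter] at key
    rw [key]
    convert Nat.add_sub_cancel_left (n := _) (m := _)
  · intro u hu hne
    rw [b.inner_dir, b.inner_dir]
    exact hR.separating.height_ne ⟨hu, hne⟩ hwS (hR.inj u hu hne)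
  · refine List.Nodup.append (hknown.nodup.filter _) ?_ ?_
    · exact (List.nodup_append.1 (List.nodup_append.1 hnodup).2.1).1.filter _
    · intro u hu hu'
      have hul := (List.mem_filter.1 hu').1
      rcases ((hknown.mem_iff u).1 (List.mem_filter.1 hu).1).2 with h | h
      · exact absurd h (not_lt.2 ((hR.mem_iff u).1 (by simp [hul])).2.le)
      · exact (List.nodup_append.1 hnodup).2.2 u h u (by simp [hul]) rfl
  · intro u
    rw [b.inner_dir, b.inner_dir, List.mem_append, List.mem_filter, List.mem_filter,
      decide_eq_true_iff, decide_eq_true_iff, hknown.mem_iff]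
    constructor
    · rintro (⟨⟨h1, _⟩, h2⟩ | ⟨h1, h2⟩)
      · exact ⟨h1, h2⟩
      · exact ⟨h2, (hR.separating.height_lt_iff (hx u h2) hwS
          ((hR.mem_iff u).1 (by simp [h1])).2).2 (hle u h1)⟩
    · rintro ⟨h1, h2⟩
      rcases lt_or_gt_of_ne (hR.inj u h1.right_mem h1.ne.symm) with h | h
      · exact Or.inl ⟨⟨h1, Or.inl h⟩, h2⟩
      · have hang := (hR.separating.height_lt_iff (hx u h1) hwS h).1 h2
        have hmem := (hR.mem_iff u).2 ⟨h1.right_mem, h⟩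
        rcases List.mem_append.1 hmem with hu | hu
        · exact Or.inl ⟨⟨h1, Or.inr hu⟩, h2⟩
        · rcases List.mem_append.1 hu with hu | hu
          · exact Or.inr ⟨hu, h1⟩
          · exact absurd hang (not_le.2 (hpost u hu))

theorem diagrams_leftCount (left known : List (Pt d)) :
    (leftCount b v θ left known).diagrams O = 1 := by
  simp [leftCount]

theorem time_leftCount {P : ℕ} (hP : ∀ s, (O s 0).length + (O s 1).length ≤ P)
    (left known : List (Pt d)) :
    (leftCount b v θ left known).time O 0 ≤ left.length + known.length + P + 7 := by
  simp only [leftCount, Prog.time_bind, Prog.time_op, Prog.time_query, Prog.time_count,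
    Prog.time_spend, time_indegree, Prog.run_op, Prog.run_query]
  have := hP (b.dir (b.angle v (left.getLastD v) - Real.pi / 2 - θ / 2))
  omega

theorem clog_two_half {n : ℕ} (hn : 2 ≤ n) : Nat.clog 2 (n - n / 2) + 1 = Nat.clog 2 n := by
  rw [Nat.clog_of_two_le one_lt_two hn]
  congr 2
  omega

/-- Number of diagrams that the binary search needs for an edge interval. -/
def EdgeInterval.cost (I : EdgeInterval d) : ℕ := I.count * Nat.clog 2 I.verts.length

theorem IsKnown.length_le {pre known : List (Pt d)} (h : IsKnown K b v pre known) {V : List (Pt d)}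
    (hV : ∀ u, u ∈ V ↔ u ∈ K.vertices) : known.length ≤ V.length :=
  (List.subperm_of_subset h.nodup fun u hu =>
    (hV u).2 ((h.mem_iff u).1 hu).1.right_mem).length_le

-- Invariant: the processed vertices `pre` followed by the stacked intervals make up `above`, and
-- every interval carries its true edge count. The summed `cost` of the stack is the potential that
-- pays for diagrams; the extra 1 per interval in the time bound pays for popping it.
open scoped Classical in
theorem search_spec (hO : IsOracle 𝔽 K hK O) {V : List (Pt d)}
    (hV : ∀ u, u ∈ V ↔ u ∈ K.vertices) {P : ℕ}
    (hP : ∀ s, (O s 0).length + (O s 1).length ≤ P)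
    (hR : IsRadialSort K b v θ above) (stack : List (EdgeInterval d)) (known : List (Pt d))
    (pre : List (Pt d)) (habove : above = pre ++ stack.flatMap EdgeInterval.verts)
    (hcount : ∀ I ∈ stack, I.count = I.verts.countP fun u => decide (EdgeAdj K v u))
    (hknown : IsKnown K b v pre known) :
    ((search b v θ stack known).run O).Nodup ∧
    (∀ u, u ∈ (search b v θ stack known).run O ↔ EdgeAdj K v u) ∧
    (search b v θ stack known).diagrams O ≤ (stack.map EdgeInterval.cost).sum ∧
    (search b v θ stack known).time O 0 ≤
      1 + (stack.map fun I => 1 + (3 * V.length + P + 9) * I.cost).sum := by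
  fun_induction search b v θ stack known generalizing pre with
  | case1 known =>
    simp only [Prog.run_op, Prog.diagrams_op, Prog.time_op]
    refine ⟨hknown.nodup, fun u => ?_, by simp, by simp⟩
    rw [hknown.mem_iff]
    refine ⟨fun h => h.1, fun h => ⟨h, ?_⟩⟩
    rcases lt_or_gt_of_ne (hR.inj u h.right_mem h.ne.symm) with h' | h'
    · exact Or.inl h'
    · right
      have := (hR.mem_iff u).2 ⟨h.right_mem, h'⟩
      simpa [habove] using this
  | case2 I stack known ih₁ ih₂ ih₃ =>
    by_cases hI : I.count = 0
    · obtain ⟨h1, h2, h3, h4⟩ := ih₁ (pre ++ I.verts) (by simp [habove])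
        (fun J hJ => hcount J (List.mem_cons_of_mem _ hJ)) ⟨hknown.nodup, fun u => by
          rw [hknown.mem_iff, List.mem_append]
          have h0 := (hcount I (by simp)).symm.trans hI
          rw [List.countP_eq_zero] at h0
          have := h0 u
          simp only [decide_eq_true_iff] at this
          tauto⟩
      simp only [Prog.run_bind, Prog.diagrams_bind, Prog.time_bind, Prog.diagrams_spend,
        Prog.time_spend, hI, if_true, List.map_cons, List.sum_cons]
      refine ⟨h1, h2, by omega, by omega⟩
    by_cases hlen : I.verts.length < 2
    · have hc := hcount I (by simp)
      obtain ⟨u, hu⟩ : ∃ u, I.verts = [u] := by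
        match hverts : I.verts with
        | [] => rw [hverts] at hc; exact absurd hc hI
        | [u] => exact ⟨u, rfl⟩
        | _ :: _ :: _ => rw [hverts] at hlen; simp at hlen
      have hadj : EdgeAdj K v u := by
        by_contra h
        rw [hu] at hc
        simp [h] at hc
        exact hI hc
      have hmem : u ∈ above := by simp [habove, hu]
      have hupre : u ∉ pre := by
        intro h
        have := hR.nodup
        rw [habove] at this
        exact (List.nodup_append.1 this).2.2 u h u (by simp [hu]) rfl
      obtain ⟨h1, h2, h3, h4⟩ := ih₂ (pre ++ I.verts) (by simp [habove])
        (fun J hJ => hcount J (List.mem_cons_of_mem _ hJ)) ⟨by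
          rw [hu]
          refine List.nodup_cons.2 ⟨fun h => ?_, hknown.nodup⟩
          rcases ((hknown.mem_iff u).1 h).2 with h | h
          · exact absurd h (not_lt.2 ((hR.mem_iff u).1 hmem).2.le)
          · exact hupre h, fun w => by
          rw [hu, List.mem_append, List.mem_append, List.mem_singleton, hknown.mem_iff]
          constructor
          · rintro (rfl | h)
            · exact ⟨hadj, Or.inr (Or.inr rfl)⟩
            · tauto
          · tauto⟩
      simp only [Prog.run_bind, Prog.diagrams_bind, Prog.time_bind, Prog.diagrams_spend,
        Prog.time_spend, hI, hlen, if_true, if_false, List.map_cons, List.sum_cons]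
      refine ⟨h1, h2, by omega, by omega⟩
    have hlen2 : 2 ≤ I.verts.length := by omega
    set left := I.verts.take (I.verts.length / 2) with hleft
    set right := I.verts.drop (I.verts.length / 2) with hright
    have hLR : left ++ right = I.verts := List.take_append_drop _ _
    have hLl : left.length = I.verts.length / 2 := by rw [hleft, List.length_take]; omega
    have hRl : right.length = I.verts.length - I.verts.length / 2 := by
      rw [hright, List.length_drop]
    have hsplit : above = pre ++ (left ++ (right ++ stack.flatMap EdgeInterval.verts)) := by
      rw [habove, List.flatMap_cons, ← hLR, List.append_assoc]
    have hne : left ≠ [] := by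
      intro h
      rw [h] at hLl
      simp only [List.length_nil] at hLl
      omega
    have hrun := run_leftCount hO (hsplit ▸ hR) hne hknown
    have hc := hcount I (by simp)
    rw [← hLR, List.countP_append] at hc
    have htime := time_leftCount (b := b) (v := v) (θ := θ) hP left known
    have habovelen : above.length ≤ V.length :=
      (List.subperm_of_subset hR.nodup fun u hu =>
        (hV u).2 ((hR.mem_iff u).1 hu).1).length_le
    have hIlen : I.verts.length ≤ above.length := by
      rw [habove, List.flatMap_cons]
      simp only [List.length_append]
      omega
    have hklen := hknown.length_le hV
    -- A split only refines the stack, so `pre` and `known` are unchanged.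
    obtain ⟨h1, h2, h3, h4⟩ := ih₃ hlen (left.countP fun u => decide (EdgeAdj K v u)) pre
      (by rw [hsplit]; rfl) (by
        intro J hJ
        rcases List.mem_cons.1 hJ with rfl | hJ
        · rfl
        · rcases List.mem_cons.1 hJ with rfl | hJ
          · simp only
            omega
          · exact hcount J (List.mem_cons_of_mem _ hJ)) hknown
    simp only [Prog.run_bind, Prog.diagrams_bind, Prog.time_bind, Prog.diagrams_spend,
      Prog.time_spend, hI, hlen, if_false, hrun, diagrams_leftCount]
    refine ⟨h1, h2, ?_⟩
    clear ih₁ ih₂ ih₃ h1 h2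
    set c₁ := left.countP fun u => decide (EdgeAdj K v u)
    set c₂ := right.countP fun u => decide (EdgeAdj K v u)
    have hsub : I.count - c₁ = c₂ := by omega
    rw [hsub] at h3 h4 ⊢
    -- The potential drops: the larger half has `clog` exactly one less than the whole, the smaller
    -- half no more than the larger, and `c₁ + c₂ ≥ 1`.
    have hq : 1 + (c₁ * Nat.clog 2 left.length + c₂ * Nat.clog 2 right.length) ≤ I.cost := by
      have hcl := clog_two_half hlen2
      rw [EdgeInterval.cost, hLl, hRl, hc, ← hcl]
      have hmono : Nat.clog 2 (I.verts.length / 2) ≤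
          Nat.clog 2 (I.verts.length - I.verts.length / 2) :=
        Nat.clog_mono_right 2 (by omega)
      have := Nat.mul_le_mul_left c₁ hmono
      have : 1 ≤ c₁ + c₂ := by omega
      nlinarith
    simp only [List.map_cons, List.sum_cons, EdgeInterval.cost] at h3 h4 hq ⊢
    set q₁ := c₁ * Nat.clog 2 left.length
    set q₂ := c₂ * Nat.clog 2 right.length
    set q := I.count * Nat.clog 2 I.verts.length
    refine ⟨by omega, ?_⟩
    -- A split takes at most `3 * V.length + P + 8` steps, and replacing one interval by two adds
    -- one more pop; this gives the constant 9.
    have hKq := Nat.mul_le_mul_left (3 * V.length + P + 9) hq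
    rw [mul_add, mul_add, mul_one] at hKq
    omega

end Search

/-! ### The sweep over all vertices -/

section Sweep

variable {d : ℕ} {𝔽 : Type*} [Field 𝔽] {K : Geometry.SimplicialComplex ℝ (Pt d)}
  {hK : K.faces.Finite} {O : Dir d → Diagram} {b : Frame d} {V : List (Pt d)} {P : ℕ}

/-- No two vertices have the same height, and no three have collinear projections. -/
structure IsGeneric (K : Geometry.SimplicialComplex ℝ (Pt d)) (b : Frame d) : Prop where
  inj : ∀ u ∈ K.vertices, ∀ v ∈ K.vertices, b.x₁ u = b.x₁ v → u = v
  not_collinear : ∀ u ∈ K.vertices, ∀ v ∈ K.vertices, ∀ w ∈ K.vertices, u ≠ v → u ≠ w → v ≠ w →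
    ¬ Collinear ℝ {b.proj u, b.proj v, b.proj w}

-- Equal angles at `v` would put three projections on a line, so the order produced by the sort is
-- strict and `minAngle` returns a positive separation.
open scoped Classical in
theorem IsGeneric.isRadialSort (hG : IsGeneric K b) {v : Pt d} (hv : v ∈ K.vertices)
    {sorted : List (Pt d)} (hnodup : sorted.Nodup)
    (hmem : ∀ u, u ∈ sorted ↔ u ∈ K.vertices ∧ b.x₁ u ≠ b.x₁ v)
    (hsorted : sorted.Pairwise fun u w => -b.angle v u ≤ -b.angle v w) :
    IsRadialSort K b v ((minAngle (d := d) (sorted.map (b.angle v))).run O)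
      (sorted.filter fun u => decide (b.x₁ v < b.x₁ u)) := by
  have hne : ∀ u, u ∈ K.vertices ∧ u ≠ v ↔ u ∈ sorted := fun u => by
    rw [hmem]
    exact ⟨fun h => ⟨h.1, fun h' => h.2 (hG.inj u h.1 v hv h')⟩,
      fun h => ⟨h.1, fun h' => h.2 (by rw [h'])⟩⟩
  have hstrict : sorted.Pairwise fun u w => b.angle v w < b.angle v u := by
    refine (hsorted.and hnodup).imp_of_mem fun {u w} hu hw h => ?_
    refine lt_of_le_of_ne (neg_le_neg_iff.1 h.1) fun heq => ?_
    have hu' := (hmem u).1 hu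
    have hw' := (hmem w).1 hw
    exact hG.not_collinear v hv u hu'.1 w hw'.1 ((hne u).2 hu).2.symm ((hne w).2 hw).2.symm h.2
      (b.collinear_of_angle_eq hu'.2 hw'.2 heq.symm)
  obtain ⟨h0, h1, h2⟩ := run_minAngle O (sorted.map (b.angle v)) (List.pairwise_map.2 hstrict)
    (fun x hx => by
      obtain ⟨u, _, rfl⟩ := List.mem_map.1 hx
      exact ⟨b.angle_pos v u, b.angle_lt_pi v u⟩)
  refine ⟨hv, fun u hu huv h => huv (hG.inj u hu v hv h), ⟨h0, fun u hu w hw => ?_,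
    fun u hu w hw => ?_⟩, hstrict.filter _, fun u => ?_⟩
  · exact h1 _ (List.mem_map_of_mem ((hne u).1 hu)) _ (List.mem_map_of_mem ((hne w).1 hw))
  · exact h2 _ (List.mem_map_of_mem ((hne u).1 hu)) _ (List.mem_map_of_mem ((hne w).1 hw))
  · rw [List.mem_filter, decide_eq_true_iff, hmem]
    exact ⟨fun h => ⟨h.1.1, h.2⟩, fun h => ⟨⟨h.1, h.2.ne'⟩, h.2⟩⟩

/-- Number of steps spent at a vertex for each edge above it, queries not included. -/
def stepsPerEdge (n P : ℕ) : ℕ :=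
  (3 * n + P + 9) * Nat.clog 2 n + (4 * n ^ 2 + 5 * n + 8)

-- Reversing `b₁` turns the indegree into the number of upward neighbours. If it is zero, only the
-- reading of the diagram, `P + 4` steps, is spent; otherwise the sorting is charged to the edges
-- found.
open scoped Classical in
theorem upEdges_spec (hO : IsOracle 𝔽 K hK O) (hG : IsGeneric K b) (hVn : V.Nodup)
    (hV : ∀ u, u ∈ V ↔ u ∈ K.vertices) (hP : ∀ s, (O s 0).length + (O s 1).length ≤ P)
    {v : Pt d} (hv : v ∈ K.vertices) {below : List (Pt d)} (hbelow : below.Nodup)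
    (hmem : ∀ u, u ∈ below ↔ EdgeAdj K v u ∧ b.x₁ u < b.x₁ v) :
    ((upEdges b V (O b.negDir) v below).run O).Nodup ∧
    (∀ u, u ∈ (upEdges b V (O b.negDir) v below).run O ↔ EdgeAdj K v u ∧ b.x₁ v < b.x₁ u) ∧
    (upEdges b V (O b.negDir) v below).diagrams O ≤
      ((upEdges b V (O b.negDir) v below).run O).length * Nat.clog 2 V.length ∧
    (upEdges b V (O b.negDir) v below).time O 0 ≤ P + 4 +
      ((upEdges b V (O b.negDir) v below).run O).length * stepsPerEdge V.length P := by
  have hind : ∀ l : List (Pt d), l.Nodup → (∀ u, u ∈ l ↔ EdgeAdj K v u ∧ b.x₁ v < b.x₁ u) →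
      (indegree (d := d) (O b.negDir) (-b.x₁ v)).run O = l.length := by
    intro l hl hmem
    rw [← b.inner_negDir]
    refine run_indegree_eq_length hO (fun u hu hne h => ?_) hl fun u => ?_
    · rw [b.inner_negDir, b.inner_negDir] at h
      exact hne (hG.inj u hu v hv (neg_injective h))
    · rw [b.inner_negDir, b.inner_negDir, neg_lt_neg_iff, hmem]
  have hindtime := time_indegree O 0 (O b.negDir) (-b.x₁ v)
  have hPn := hP b.negDir
  simp only [upEdges, Prog.run_bind, Prog.diagrams_bind, Prog.time_bind, diagrams_indegree,
    hindtime]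
  by_cases hc : (indegree (d := d) (O b.negDir) (-b.x₁ v)).run O = 0
  · simp only [hc, if_true, Prog.run_op, Prog.diagrams_op, Prog.time_op]
    have h0 := hind (V.filter fun u => decide (EdgeAdj K v u ∧ b.x₁ v < b.x₁ u)) (hVn.filter _)
      fun u => by
        rw [List.mem_filter, decide_eq_true_iff]
        exact ⟨fun h => h.2, fun h => ⟨(hV u).2 h.1.right_mem, h⟩⟩
    rw [hc] at h0
    have hnil := List.length_eq_zero_iff.1 h0.symm
    refine ⟨List.nodup_nil, fun u => ?_, by simp, by omega⟩
    simp only [List.not_mem_nil, false_iff]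
    intro h
    have : u ∈ V.filter fun u => decide (EdgeAdj K v u ∧ b.x₁ v < b.x₁ u) := by
      rw [List.mem_filter, decide_eq_true_iff]
      exact ⟨(hV u).2 h.1.right_mem, h⟩
    rw [hnil] at this
    exact absurd this List.not_mem_nil
  · simp only [hc, if_false, Prog.run_bind, Prog.diagrams_bind, Prog.time_bind, Prog.run_select,
      Prog.diagrams_select, Prog.time_select, Prog.run_mapList, Prog.diagrams_mapList,
      Prog.time_mapList, diagrams_minAngle]
    set others := V.filter fun u => decide (b.x₁ u ≠ b.x₁ v) with hothers
    obtain ⟨hmd, hmt, hperm, hsorted⟩ :=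
      Prog.mergeSort_spec O 0 (fun u => -b.angle v u) others
    set sorted := (Prog.mergeSort (d := d) (fun u => -b.angle v u) others).run O
    have hR := hG.isRadialSort (O := O) hv (hperm.nodup_iff.2 (hVn.filter _)) (fun u => by
      rw [hperm.mem_iff, hothers, List.mem_filter, decide_eq_true_iff, hV]) hsorted
    have hθt := time_minAngle O 0 (sorted.map (b.angle v))
    set θ := (minAngle (d := d) (sorted.map (b.angle v))).run O
    set above := sorted.filter fun u => decide (b.x₁ v < b.x₁ u) with habove
    have hcount : (indegree (d := d) (O b.negDir) (-b.x₁ v)).run O =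
        above.countP fun u => decide (EdgeAdj K v u) := by
      rw [List.countP_eq_length_filter]
      refine hind _ (hR.nodup.filter _) fun u => ?_
      rw [List.mem_filter, decide_eq_true_iff, hR.mem_iff]
      exact ⟨fun h => ⟨h.2, h.1.2⟩, fun h => ⟨⟨h.1.right_mem, h.2⟩, h.1⟩⟩
    set c := (indegree (d := d) (O b.negDir) (-b.x₁ v)).run O
    obtain ⟨h1, h2, h3, h4⟩ := search_spec hO hV hP hR [⟨above, c⟩] below [] (by simp)
      (fun I hI => by rw [List.mem_singleton.1 hI]; exact hcount)
      ⟨hbelow, fun u => by rw [hmem]; simp⟩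
    set res := (search b v θ [⟨above, c⟩] below).run O
    have hup : ∀ u, u ∈ res.filter (fun u => decide (b.x₁ v < b.x₁ u)) ↔
        EdgeAdj K v u ∧ b.x₁ v < b.x₁ u := fun u => by
      rw [List.mem_filter, decide_eq_true_iff, h2]
    have hlen := hind _ (h1.filter fun u => decide (b.x₁ v < b.x₁ u)) hup
    have hothersV : others.length ≤ V.length := List.length_filter_le _ _
    have hsortedlen : sorted.length = others.length := hperm.length_eq
    have habovelen : above.length ≤ V.length := (List.length_filter_le _ _).trans (by omega)
    have hreslen : res.length ≤ V.length := (List.subperm_of_subset h1 fun u hu =>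
      (hV u).2 ((h2 u).1 hu).right_mem).length_le
    simp only [EdgeInterval.cost, List.map_cons, List.map_nil, List.sum_cons, List.sum_nil,
      add_zero] at h3 h4
    have hclog : c * Nat.clog 2 above.length ≤ c * Nat.clog 2 V.length :=
      Nat.mul_le_mul_left _ (Nat.clog_mono_right 2 habovelen)
    refine ⟨h1.filter _, hup, ?_, ?_⟩
    · rw [← hlen]
      omega
    · rw [← hlen]
      have e1 := Nat.mul_le_mul_left (3 * V.length + P + 9) hclog
      have e2 : others.length ^ 2 ≤ V.length ^ 2 := Nat.pow_le_pow_left hothersV 2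
      -- The branch has `c ≥ 1`, so the one-time cost at `v` may be charged once for each upward
      -- edge.
      have e3 : 1 * (4 * V.length ^ 2 + 5 * V.length + 8) ≤
          c * (4 * V.length ^ 2 + 5 * V.length + 8) := Nat.mul_le_mul_right _ (by omega)
      have e4 : c * stepsPerEdge V.length P = (3 * V.length + P + 9) * (c * Nat.clog 2 V.length) +
          c * (4 * V.length ^ 2 + 5 * V.length + 8) := by rw [stepsPerEdge]; ring
      simp only [List.length_map] at hθt ⊢
      omega

theorem edgeOf_injective_of_lt {e e' : Pt d × Pt d} (he : b.x₁ e.1 < b.x₁ e.2)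
    (he' : b.x₁ e'.1 < b.x₁ e'.2) (h : edgeOf e = edgeOf e') : e = e' := by
  have h1 : e.1 ∈ edgeOf e' := h ▸ mem_edgeOf.2 (Or.inl rfl)
  have h2 : e.2 ∈ edgeOf e' := h ▸ mem_edgeOf.2 (Or.inr rfl)
  rcases mem_edgeOf.1 h1 with h1 | h1 <;> rcases mem_edgeOf.1 h2 with h2 | h2
  · rw [h1, h2] at he
    exact absurd he (lt_irrefl _)
  · exact Prod.ext h1 h2
  · rw [h1, h2] at he
    exact absurd he' he.asymm
  · rw [h1, h2] at he
    exact absurd he (lt_irrefl _)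

/-- `edges` lists the edges of `K` whose lower vertex is in `done`, as pairs (lower vertex, upper
vertex). -/
structure IsEdgeList (K : Geometry.SimplicialComplex ℝ (Pt d)) (b : Frame d) (done : List (Pt d))
    (edges : List (Pt d × Pt d)) : Prop where
  nodup : edges.Nodup
  mem_iff : ∀ e, e ∈ edges ↔ e.1 ∈ done ∧ EdgeAdj K e.1 e.2 ∧ b.x₁ e.1 < b.x₁ e.2

theorem IsEdgeList.nodup_map {done : List (Pt d)} {edges : List (Pt d × Pt d)}
    (h : IsEdgeList K b done edges) : (edges.map edgeOf).Nodup :=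
  h.nodup.map_on fun e he e' he' heq =>
    edgeOf_injective_of_lt ((h.mem_iff e).1 he).2.2 ((h.mem_iff e').1 he').2.2 heq

theorem edgeSet_finite (hK : K.faces.Finite) : (edgeSet K).Finite :=
  hK.subset fun _ h => h.1

theorem IsEdgeList.length_le (hK : K.faces.Finite) {done : List (Pt d)}
    {edges : List (Pt d × Pt d)} (h : IsEdgeList K b done edges) :
    edges.length ≤ (edgeSet K).ncard := by
  classical
  rw [← List.length_map (f := edgeOf), ← List.toFinset_card_of_nodup h.nodup_map,
    ← Set.ncard_coe_finset]
  refine Set.ncard_le_ncard (fun σ hσ => ?_) (edgeSet_finite hK)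
  obtain ⟨e, he, rfl⟩ := List.mem_map.1 (List.mem_toFinset.1 (Finset.mem_coe.1 hσ))
  exact ((h.mem_iff e).1 he).2.1

theorem IsEdgeList.mem_map_iff (hG : IsGeneric K b) {done : List (Pt d)}
    (hdone : ∀ v ∈ K.vertices, v ∈ done) {edges : List (Pt d × Pt d)}
    (h : IsEdgeList K b done edges) (σ : Finset (Pt d)) :
    σ ∈ edges.map edgeOf ↔ σ ∈ edgeSet K := by
  constructor
  · intro hσ
    obtain ⟨e, he, rfl⟩ := List.mem_map.1 hσ
    exact ((h.mem_iff e).1 he).2.1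
  · intro hσ
    obtain ⟨u, w, huw, rfl⟩ := exists_edgeOf_eq hσ.2
    have hadj : EdgeAdj K u w := hσ
    rcases lt_or_gt_of_ne (fun heq => huw (hG.inj u hadj.left_mem w hadj.right_mem heq)) with h' | h'
    · exact List.mem_map.2 ⟨(u, w), (h.mem_iff _).2 ⟨hdone u hadj.left_mem, hadj, h'⟩, rfl⟩
    · exact List.mem_map.2 ⟨(w, u), (h.mem_iff _).2 ⟨hdone w hadj.right_mem, hadj.symm, h'⟩,
        edgeOf_comm w u⟩

theorem IsEdgeList.length_eq (hG : IsGeneric K b) {done : List (Pt d)}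
    (hdone : ∀ v ∈ K.vertices, v ∈ done) {edges : List (Pt d × Pt d)}
    (h : IsEdgeList K b done edges) : edges.length = (edgeSet K).ncard := by
  classical
  rw [← List.length_map (f := edgeOf), ← List.toFinset_card_of_nodup h.nodup_map,
    ← Set.ncard_coe_finset]
  congr 1
  ext σ
  rw [Finset.mem_coe, List.mem_toFinset, h.mem_map_iff hG hdone]

-- Amortised form: the cost still to come, plus the charge of the edges found so far, is at most the
-- charge of the final edge list (for the time, plus a fixed cost for each remaining vertex). The `+
-- 2` per edge pays for forming its pair and appending it.
open scoped Classical in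
theorem sweep_spec (hO : IsOracle 𝔽 K hK O) (hG : IsGeneric K b) (hVn : V.Nodup)
    (hV : ∀ u, u ∈ V ↔ u ∈ K.vertices) (hP : ∀ s, (O s 0).length + (O s 1).length ≤ P)
    (done rest : List (Pt d)) (edges : List (Pt d × Pt d))
    (hnodup : (done ++ rest).Nodup) (hmem : ∀ u, u ∈ done ++ rest ↔ u ∈ K.vertices)
    (hsorted : (done ++ rest).Pairwise fun u w => b.x₁ u ≤ b.x₁ w)
    (hedges : IsEdgeList K b done edges) :
    IsEdgeList K b (done ++ rest) ((sweep b V (O b.negDir) rest edges).run O) ∧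
    (sweep b V (O b.negDir) rest edges).diagrams O + edges.length * Nat.clog 2 V.length ≤
      ((sweep b V (O b.negDir) rest edges).run O).length * Nat.clog 2 V.length ∧
    (sweep b V (O b.negDir) rest edges).time O 0 + edges.length * (stepsPerEdge V.length P + 2) ≤
      rest.length * (2 * (edgeSet K).ncard + P + 7) + 1 +
      ((sweep b V (O b.negDir) rest edges).run O).length * (stepsPerEdge V.length P + 2) := by
  induction rest generalizing done edges with
  | nil =>
    simp only [sweep, Prog.run_op, Prog.diagrams_op, Prog.time_op, List.append_nil]
    exact ⟨hedges, by omega, by omega⟩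
  | cons v rest ih =>
    have hv : v ∈ K.vertices := (hmem v).1 (by simp)
    have hvdone : v ∉ done := fun h => (List.nodup_append.1 hnodup).2.2 v h v (by simp) rfl
    have hincoming : ∀ e, e ∈ edges.filter (fun e => decide (b.x₁ e.2 = b.x₁ v)) ↔
        e ∈ edges ∧ e.2 = v := by
      intro e
      rw [List.mem_filter, decide_eq_true_iff]
      exact and_congr_right fun he => ⟨hG.inj _ ((hedges.mem_iff e).1 he).2.1.right_mem _ hv,
        fun h => by rw [h]⟩
    have hbn : ((edges.filter fun e => decide (b.x₁ e.2 = b.x₁ v)).map Prod.fst).Nodup :=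
      (hedges.nodup.filter _).map_on fun e he e' he' h =>
        Prod.ext h (((hincoming e).1 he).2.trans ((hincoming e').1 he').2.symm)
    have hbm : ∀ u, u ∈ (edges.filter fun e => decide (b.x₁ e.2 = b.x₁ v)).map Prod.fst ↔
        EdgeAdj K v u ∧ b.x₁ u < b.x₁ v := by
      intro u
      rw [List.mem_map]
      constructor
      · rintro ⟨⟨u, w⟩, he, rfl⟩
        obtain ⟨he', rfl⟩ := (hincoming _).1 he
        have := (hedges.mem_iff _).1 he'
        exact ⟨this.2.1.symm, this.2.2⟩
      · rintro ⟨h1, h2⟩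
        refine ⟨(u, v), (hincoming _).2 ⟨(hedges.mem_iff _).2 ⟨?_, h1.symm, h2⟩, rfl⟩, rfl⟩
        -- A neighbour lower than `v` comes before `v` in the sorted order, so its edge to `v` has
        -- already been found.
        rcases List.mem_append.1 ((hmem u).2 h1.right_mem) with h | h
        · exact h
        · rcases List.mem_cons.1 h with h | h
          · exact absurd h h1.ne.symm
          · exact absurd ((List.pairwise_cons.1 (List.pairwise_append.1 hsorted).2.1).1 u h)
              (not_le.2 h2)
    have hinlen : (edges.filter fun e => decide (b.x₁ e.2 = b.x₁ v)).length ≤ edges.length :=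
      List.length_filter_le _ _
    have hedgeslen := hedges.length_le hK
    simp only [sweep, Prog.run_bind, Prog.diagrams_bind, Prog.time_bind, Prog.run_select,
      Prog.diagrams_select, Prog.time_select, Prog.run_mapList, Prog.diagrams_mapList,
      Prog.time_mapList, Prog.diagrams_spend, Prog.time_spend]
    set incoming := edges.filter fun e => decide (b.x₁ e.2 = b.x₁ v)
    obtain ⟨h1, h2, h3, h4⟩ := upEdges_spec hO hG hVn hV hP hv hbn hbm
    set up := (upEdges b V (O b.negDir) v (incoming.map Prod.fst)).run O
    have happ : done ++ v :: rest = (done ++ [v]) ++ rest := by simp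
    obtain ⟨h5, h6, h7⟩ := ih (done ++ [v]) (up.map (fun u => (v, u)) ++ edges) (happ ▸ hnodup)
      (happ ▸ hmem) (happ ▸ hsorted) ⟨by
        refine List.Nodup.append (h1.map fun u w h => (Prod.ext_iff.1 h).2) hedges.nodup ?_
        intro e he he'
        obtain ⟨u, _, rfl⟩ := List.mem_map.1 he
        exact hvdone ((hedges.mem_iff _).1 he').1, by
        rintro ⟨u, w⟩
        rw [List.mem_append, List.mem_map, hedges.mem_iff, List.mem_append, List.mem_singleton]
        constructor
        · rintro (⟨x, hx, h⟩ | h)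
          · obtain ⟨rfl, rfl⟩ := Prod.ext_iff.1 h
            exact ⟨Or.inr rfl, (h2 _).1 hx⟩
          · exact ⟨Or.inl h.1, h.2⟩
        · rintro ⟨h | h, h'⟩
          · exact Or.inr ⟨h, h'⟩
          · obtain rfl : u = v := h
            exact Or.inl ⟨w, (h2 w).2 h', rfl⟩⟩
    rw [happ]
    refine ⟨h5, ?_, ?_⟩
    · rw [List.length_append, List.length_map, add_mul] at h6
      omega
    · rw [List.length_append, List.length_map, add_mul, mul_add up.length] at h7
      rw [List.length_cons, Nat.add_one_mul, List.length_map]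
      omega

theorem length_eq_ncard (hVn : V.Nodup) (hV : ∀ u, u ∈ V ↔ u ∈ K.vertices) :
    V.length = K.vertices.ncard := by
  classical
  rw [← List.toFinset_card_of_nodup hVn, ← Set.ncard_coe_finset]
  congr 1
  ext u
  rw [Finset.mem_coe, List.mem_toFinset, hV]

theorem length_diagrams_le (hO : IsOracle 𝔽 K hK O) (s : Dir d) :
    (O s 0).length + (O s 1).length ≤ K.vertices.ncard + (edgeSet K).ncard := by
  refine Nat.add_le_add ((length_diagram_le 𝔽 hO s 0).trans ?_) (length_diagram_le 𝔽 hO s 1)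
  rw [← Set.ncard_image_of_injective K.vertices (Finset.singleton_injective)]
  refine Set.ncard_le_ncard (fun σ hσ => ?_) (hK.subset ?_)
  · obtain ⟨v, rfl⟩ := Finset.card_eq_one.1 hσ.2
    exact ⟨v, hσ.1, rfl⟩
  · rintro _ ⟨v, hv, rfl⟩
    exact hv

theorem findEdges_spec (hO : IsOracle 𝔽 K hK O) (hG : IsGeneric K b) (hVn : V.Nodup)
    (hV : ∀ u, u ∈ V ↔ u ∈ K.vertices) {n m : ℕ} (hn : K.vertices.ncard = n)
    (hm : (edgeSet K).ncard = m) :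
    (((findEdges b V).run O).map edgeOf).Nodup ∧
    (∀ σ, σ ∈ ((findEdges b V).run O).map edgeOf ↔ σ ∈ edgeSet K) ∧
    (findEdges b V).diagrams O ≤ 1 + m * Nat.clog 2 n ∧
    (findEdges b V).time O 0 ≤
      4 * n ^ 2 + 2 + n * (n + 3 * m + 7) + m * (stepsPerEdge n (n + m) + 2) := by
  obtain ⟨hd, ht, hperm, hsorted⟩ := Prog.mergeSort_spec O 0 b.x₁ V
  have hlen := length_eq_ncard hVn hV
  have hmem : ∀ u, u ∈ (Prog.mergeSort (d := d) b.x₁ V).run O ↔ u ∈ K.vertices := fun u => by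
    rw [hperm.mem_iff, hV]
  obtain ⟨h1, h2, h3⟩ := sweep_spec hO hG hVn hV (length_diagrams_le hO) []
    ((Prog.mergeSort (d := d) b.x₁ V).run O) [] (hperm.nodup_iff.2 hVn) hmem hsorted
    ⟨List.nodup_nil, by simp⟩
  rw [List.nil_append] at h1
  have hdone : ∀ v ∈ K.vertices, v ∈ (Prog.mergeSort (d := d) b.x₁ V).run O :=
    fun v hv => (hmem v).2 hv
  rw [h1.length_eq hG hdone, hlen, hn, hm] at h2 h3
  rw [hperm.length_eq, hlen, hn] at h3
  simp only [findEdges, Prog.run_bind, Prog.diagrams_bind, Prog.time_bind, Prog.run_query,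
    Prog.diagrams_query, Prog.time_query]
  refine ⟨h1.nodup_map, h1.mem_map_iff hG hdone, ?_, ?_⟩
  · simp only [List.length_nil, zero_mul] at h2
    omega
  · rw [hlen, hn] at ht
    simp only [List.length_nil, zero_mul] at h3
    rw [show 2 * m + (n + m) + 7 = n + 3 * m + 7 by ring] at h3
    omega

theorem ncard_edgeSet_le_sq (hK : K.faces.Finite) :
    (edgeSet K).ncard ≤ K.vertices.ncard ^ 2 := by
  have hfin : K.vertices.Finite :=
    (hK.preimage Finset.singleton_injective.injOn : ((fun v => {v}) ⁻¹' K.faces).Finite)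
  rw [sq, ← Set.ncard_prod]
  refine (Set.ncard_le_ncard (t := edgeOf '' (K.vertices ×ˢ K.vertices)) ?_
    ((hfin.prod hfin).image _)).trans (Set.ncard_image_le (hfin.prod hfin))
  intro σ hσ
  obtain ⟨u, w, _, rfl⟩ := exists_edgeOf_eq hσ.2
  have hadj : EdgeAdj K u w := hσ
  exact ⟨(u, w), ⟨hadj.left_mem, hadj.right_mem⟩, rfl⟩

theorem two_le_ncard_vertices (hK : K.faces.Finite) (h : (edgeSet K).ncard ≠ 0) :
    2 ≤ K.vertices.ncard := by
  have hfin : K.vertices.Finite :=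
    (hK.preimage Finset.singleton_injective.injOn : ((fun v => {v}) ⁻¹' K.faces).Finite)
  obtain ⟨σ, hσ⟩ := Set.nonempty_of_ncard_ne_zero h
  rw [← hσ.2, ← Set.ncard_coe_finset]
  refine Set.ncard_le_ncard (fun v hv => ?_) hfin
  exact K.down_closed hσ.1 (Finset.singleton_subset_iff.2 hv) (Finset.singleton_nonempty v)

end Sweep

/-! ### Numerical estimates and the theorem -/

/-- From `clog - 1 < log n / log 2` and `log 2 ≤ log n` it follows that `clog < 2 log n / log 2`,
and `2 / log 2 < 3`. -/
theorem clog_two_le_three_mul_log {n : ℕ} (hn : 2 ≤ n) : (Nat.clog 2 n : ℝ) ≤ 3 * Real.log n := by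
  have h2 : (0.6931471803 : ℝ) < Real.log 2 := Real.log_two_gt_d9
  have hlog : Real.log 2 ≤ Real.log n :=
    Real.log_le_log (by norm_num) (by exact_mod_cast hn)
  have hc : 0 < Nat.clog 2 n := Nat.clog_pos one_lt_two hn
  have hpow : 2 ^ (Nat.clog 2 n - 1) < n := Nat.pow_pred_clog_lt_self one_lt_two hn
  have hl : ((Nat.clog 2 n - 1 : ℕ) : ℝ) * Real.log 2 < Real.log n := by
    rw [← Real.log_pow]
    exact Real.log_lt_log (by positivity) (by exact_mod_cast hpow)
  rw [Nat.cast_sub hc] at hl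
  push_cast at hl
  nlinarith

theorem mul_clog_le_mul_log {n m : ℕ} (hn : m ≠ 0 → 2 ≤ n) :
    (m : ℝ) * Nat.clog 2 n ≤ 3 * (m * Real.log n) := by
  rcases Nat.eq_zero_or_pos m with rfl | hm
  · simp
  · have := mul_le_mul_of_nonneg_left (clog_two_le_three_mul_log (hn hm.ne')) m.cast_nonneg (α := ℝ)
    linarith

theorem le_two_mul_mul_log {n m : ℕ} (hn : m ≠ 0 → 2 ≤ n) : (m : ℝ) ≤ 2 * (m * Real.log n) := by
  rcases Nat.eq_zero_or_pos m with rfl | hm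
  · simp
  · have h2 : (0.6931471803 : ℝ) < Real.log 2 := Real.log_two_gt_d9
    have hlog : Real.log 2 ≤ Real.log n :=
      Real.log_le_log (by norm_num) (by exact_mod_cast hn hm.ne')
    have : (0 : ℝ) < m := by exact_mod_cast hm
    nlinarith

theorem steps_bound {n m : ℕ} (hn : m ≠ 0 → 2 ≤ n) (hm : m ≤ n ^ 2) :
    4 * n ^ 2 + 2 + n * (n + 3 * m + 7) + m * (stepsPerEdge n (n + m) + 2) ≤
      2 + 12 * n ^ 2 + 22 * (m * n ^ 2) + 14 * (m * Nat.clog 2 n * n ^ 2) := by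
  rcases Nat.eq_zero_or_pos m with rfl | hm0
  · nlinarith [Nat.le_self_pow two_ne_zero n]
  -- With an edge present, `1`, `n` and `m` are all at most `n ^ 2`, so every lower-order term is
  -- absorbed into `n ^ 2`.
  · have h1 : n ≤ n ^ 2 := Nat.le_self_pow two_ne_zero n
    have h2 : 1 ≤ n ^ 2 := Nat.one_le_pow _ _ (by have := hn hm0.ne'; omega)
    have e1 : (3 * n + (n + m) + 9) * Nat.clog 2 n ≤ 14 * n ^ 2 * Nat.clog 2 n :=
      Nat.mul_le_mul_right _ (by omega)
    have e2 : m * (stepsPerEdge n (n + m) + 2) ≤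
        m * (14 * n ^ 2 * Nat.clog 2 n + 19 * n ^ 2) :=
      Nat.mul_le_mul_left _ (by rw [stepsPerEdge]; omega)
    have e3 : m * n ≤ m * n ^ 2 := Nat.mul_le_mul_left _ h1
    nlinarith

theorem mainTheorem5 :
    ∃ C : ℝ, ∀ (d : ℕ) (𝔽 : Type*) [Field 𝔽] (b : Frame d)
      (K : Geometry.SimplicialComplex ℝ (Pt d)) (hK : K.faces.Finite),
      -- distinct heights in direction `b₁`
      (∀ u ∈ K.vertices, ∀ v ∈ K.vertices, b.x₁ u = b.x₁ v → u = v) →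
      -- no three vertices project to collinear points of the plane
      (∀ u ∈ K.vertices, ∀ v ∈ K.vertices, ∀ w ∈ K.vertices, u ≠ v → u ≠ w → v ≠ w →
        ¬ Collinear ℝ {b.proj u, b.proj v, b.proj w}) →
      ∀ (O : Dir d → Diagram), IsOracle 𝔽 K hK O →
      ∀ V : List (Pt d), V.Nodup → (∀ v, v ∈ V ↔ v ∈ K.vertices) →
        -- every edge is reported, exactly once, and nothing else is
        (((findEdges b V).run O).map edgeOf).Nodup ∧
        (∀ σ, σ ∈ ((findEdges b V).run O).map edgeOf ↔ σ ∈ edgeSet K) ∧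
        -- number of diagrams
        ((findEdges b V).diagrams O : ℝ) ≤
          C * ((edgeSet K).ncard * Real.log K.vertices.ncard + 1) ∧
        -- running time, where one query takes time `T`
        ∀ T : ℕ, 1 ≤ T → ((findEdges b V).time O T : ℝ) ≤
          C * (((edgeSet K).ncard * Real.log K.vertices.ncard + 1) *
            ((K.vertices.ncard : ℝ) ^ 2 + T)) := by
  -- The largest coefficient that arises is `22 * 2 + 14 * 3 = 86`, on `X * n ^ 2` with `X = m * log
  -- n`; 100 leaves room.
  refine ⟨100, fun d 𝔽 _ b K hK h1 h2 O hO V hVn hV => ?_⟩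
  have hn := two_le_ncard_vertices hK
  have hm := ncard_edgeSet_le_sq hK
  obtain ⟨hnodup, hmem, hdiag, htime⟩ := findEdges_spec hO ⟨h1, h2⟩ hVn hV rfl rfl
  set n := K.vertices.ncard
  set m := (edgeSet K).ncard
  have hX := mul_clog_le_mul_log hn
  have hX2 := le_two_mul_mul_log hn
  have hX0 : 0 ≤ (m : ℝ) * Real.log n := mul_nonneg m.cast_nonneg (Real.log_natCast_nonneg n)
  have hdiag' : ((findEdges b V).diagrams O : ℝ) ≤ 1 + m * Nat.clog 2 n := by exact_mod_cast hdiag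
  refine ⟨hnodup, hmem, by linarith, fun T hT => ?_⟩
  have htime' : ((findEdges b V).time O 0 : ℝ) ≤
      2 + 12 * n ^ 2 + 22 * (m * n ^ 2) + 14 * (m * Nat.clog 2 n * n ^ 2) := by
    exact_mod_cast htime.trans (steps_bound hn hm)
  rw [Prog.time_eq]
  push_cast
  set X := (m : ℝ) * Real.log n
  have hT' : (1 : ℝ) ≤ T := by exact_mod_cast hT
  have hn2 : (0 : ℝ) ≤ (n : ℝ) ^ 2 := by positivity
  have e1 : (T : ℝ) * (findEdges b V).diagrams O ≤ T * (1 + 3 * X) :=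
    mul_le_mul_of_nonneg_left (by linarith) (by linarith)
  have e2 := mul_le_mul_of_nonneg_right hX2 hn2
  have e3 := mul_le_mul_of_nonneg_right hX hn2
  have e4 : 0 ≤ X * (n : ℝ) ^ 2 := mul_nonneg hX0 hn2
  have e5 : 0 ≤ X * (T : ℝ) := mul_nonneg hX0 (by linarith)
  linarith
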